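/- **Setting.** Let $n\ge 1$, $0\le\gamma<1$, $\alpha=\frac{4}{3+\gamma}$ and $\Delta_\infty u=\sum_{i,j}D_{ij}u\,D_iu\,D_ju$. Let $\delta>0$ and let $\mathcal B:\mathbb R\to\mathbb R$ be Lipschitz with $0\le\mathcal B\le1$ on $[0,\infty)$, $\mathcal B(s)=0$ for $s\le\delta/2$ and $\mathcal B(s)=1$ for $s\ge\delta$; put $\mathcal B_\varepsilon(s)=\mathcal B(s/\varepsilon^\alpha)$. For a bounded domain $\Omega\subset\mathbb R^n$ consider $(P_0)$: $\Delta_\infty u=u^{-\gamma}$ in $\Omega\cap\{u>0\}$, $u=\varphi$ on $\partial\Omega$; $(P_\varepsilon)$: $\Delta_\infty u=\mathcal B_\varepsilon(u)\,u^{-\gamma}$ in $\Omega$, $u=\varphi_\varepsilon$ on $\partial\Omega$, in the viscosity sense, where $\mathcal B_\varepsilon(s)s^{-\gamma}$ is read as $0$ for $s\le 0$. The minimal solution of $(P_\varepsilon)$ is the nonnegative viscosity solution $u_\varepsilon\in C(\overline\Omega)$ that lies below every viscosity supersolution in $C(\overline\Omega)$ with the same boundary values. A function $u\in C(\overline\Omega)$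 with $u=\varphi$ on $\partial\Omega$ is a *limiting solution* of $(P_0)$ if there are nonnegative $\varphi_\varepsilon\in W^{2,\infty}(\partial\Omega)$ ($\varepsilon>0$) with $\varphi_\varepsilon\to\varphi$ uniformly on $\partial\Omega$ as $\varepsilon\to0^+$, such that $(P_\varepsilon)$ has a minimal solution $u_\varepsilon$ for every $\varepsilon>0$ and $u_\varepsilon\to u$ locally uniformly in $\Omega$. **Proposition 6.1.** Let $C,R>0$ satisfy $$R=\Big(\frac{C}{C_\alpha}\Big)^{1/\alpha},\qquad C_\alpha=\Big(\frac1{\alpha^3(\alpha-1)}\Big)^{\frac1{3+\gamma}},$$ and let $\omega(x)=C_\alpha|x|^\alpha$. Then: 1. $\omega$ is a limiting solution of $(P_0)$ in $\Omega=B_R$ with $\varphi=C$ on $\partial B_R$. The data can be chosen as constants $C_\varepsilon\to C$ such that the minimal solutions $u_\varepsilon$ are radial and converge to $\omega$ uniformly on $\overline{B_R}$. Moreover $\omega$ is a nonnegative viscosity solution of $(P_0)$ in $B_R$ with $\varphi=C$. 2. For $\varepsilon>0$ let $\omega_\varepsilon(x)=C_\alpha(|x|+\varepsilon)^\alpha$.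 If $\delta\le C_\alpha$, then $\Delta_\infty\omega_\varepsilon=\mathcal B_\varepsilon(\omega_\varepsilon)\,\omega_\varepsilon^{-\gamma}$ in $B_R\setminus\{0\}$. Without this restriction on $\delta$: $\omega_\varepsilon=C_\alpha(R+\varepsilon)^\alpha$ on $\partial B_R$, which tends to $C$ as $\varepsilon\to0^+$; $\omega_\varepsilon\to\omega$ uniformly on $\overline{B_R}$; $\min_{B_R}\omega_\varepsilon=C_\alpha\varepsilon^\alpha$; and $\partial\{\omega_\varepsilon>C_\alpha\varepsilon^\alpha\}\cap B_R=\{0\}$. 3. The free boundary of $\omega$ is a point: $\partial\{\omega>0\}\cap B_R=\{0\}$. 4. The exponent $\alpha$ is optimal: $\sup_{B_r}\omega=C_\alpha r^\alpha$ for $0<r\le R$, and $\omega$ is of class $C^{1,\alpha-1}$ at the free boundary point $0$ but not of class $C^{1,\beta}$ at $0$ for any $\beta>\alpha-1$. Here $u$ is of class $C^{1,\beta}$ at $x$ if there are a linear map $p$ and constants $K$, $r>0$ with $|u(y)-u(x)-p(y-x)|\le K|y-x|^{1+\beta}$ for $y\in B_r(x)$. -/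

import Mathlib

open Set Filter Topology
open scoped ContDiff

namespace SingInf

noncomputable section

/-- `E n` is `ℝⁿ` with the Euclidean norm. -/
abbrev E (n : ℕ) : Type := EuclideanSpace ℝ (Fin n)

/-- The infinity Laplacian `Δ_∞ φ (x) = ∑ᵢⱼ Dᵢⱼφ(x) Dᵢφ(x) Dⱼφ(x) = ⟨D²φ(x) Dφ(x), Dφ(x)⟩`,
meaningful where `φ` is twice continuously differentiable. -/
def infLaplacian {n : ℕ} (φ : E n → ℝ) (x : E n) : ℝ :=
  fderiv ℝ (fderiv ℝ φ) x (gradient φ x) (gradient φ x)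

/-- Viscosity subsolution of `Δ_∞ u = G(u)` in the open set `Ω`. -/
def IsViscositySub {n : ℕ} (G : ℝ → ℝ) (Ω : Set (E n)) (u : E n → ℝ) : Prop :=
  ContinuousOn u Ω ∧ ∀ x ∈ Ω, ∀ φ : E n → ℝ, ContDiffAt ℝ 2 φ x →
    IsLocalMax (fun y => u y - φ y) x → G (u x) ≤ infLaplacian φ x

/-- Viscosity supersolution of `Δ_∞ u = G(u)` in the open set `Ω`. -/
def IsViscositySuper {n : ℕ} (G : ℝ → ℝ) (Ω : Set (E n)) (u : E n → ℝ) : Prop :=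
  ContinuousOn u Ω ∧ ∀ x ∈ Ω, ∀ φ : E n → ℝ, ContDiffAt ℝ 2 φ x →
    IsLocalMin (fun y => u y - φ y) x → infLaplacian φ x ≤ G (u x)

/-- Viscosity solution of `Δ_∞ u = G(u)` in the open set `Ω`. -/
def IsViscositySol {n : ℕ} (G : ℝ → ℝ) (Ω : Set (E n)) (u : E n → ℝ) : Prop :=
  IsViscositySub G Ω u ∧ IsViscositySuper G Ω u

/-- The exponent `α = 4 / (3 + γ)`. -/
def alpha (γ : ℝ) : ℝ := 4 / (3 + γ)

/-- The constant `C_α = (1 / (α³ (α - 1))) ^ (1 / (3 + γ))`. -/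
def radialConst (γ : ℝ) : ℝ :=
  (1 / (alpha γ ^ 3 * (alpha γ - 1))) ^ (1 / (3 + γ))

/-- The admissible cut-off functions `𝓑` with parameter `δ > 0`. -/
structure IsCutoff (δ : ℝ) (B : ℝ → ℝ) : Prop where
  delta_pos : 0 < δ
  lipschitz : ∃ K : NNReal, LipschitzWith K B
  mem_Icc : ∀ s, 0 ≤ s → B s ∈ Icc (0 : ℝ) 1
  eq_zero : ∀ s, s ≤ δ / 2 → B s = 0
  eq_one : ∀ s, δ ≤ s → B s = 1

/-- The right-hand side `s ↦ 𝓑_ε(s) s^(-γ)`, where `𝓑_ε(s) = 𝓑(s / ε^α)`.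
For an admissible cut-off and `ε > 0` it vanishes for all `s ≤ δ ε^α / 2`. -/
def penalizedRHS (γ : ℝ) (B : ℝ → ℝ) (ε : ℝ) (s : ℝ) : ℝ :=
  B (s / ε ^ alpha γ) * s ^ (-γ)

/-- `u ∈ C(closure Ω)` is a viscosity supersolution of the penalized Dirichlet problem
`Δ_∞ u = 𝓑_ε(u) u^(-γ)` in `Ω`, with `u = φ` on `∂Ω`. -/
structure IsPenalizedSuper {n : ℕ} (γ : ℝ) (B : ℝ → ℝ) (ε : ℝ) (Ω : Set (E n))
    (φ u : E n → ℝ) : Prop where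
  continuousOn : ContinuousOn u (closure Ω)
  boundary : EqOn u φ (frontier Ω)
  super : IsViscositySuper (penalizedRHS γ B ε) Ω u

/-- `u` is the nonnegative minimal (Perron) solution of the penalized Dirichlet problem: a
nonnegative continuous viscosity solution that lies below every continuous viscosity supersolution
with the same boundary values. -/
structure IsMinimalSol {n : ℕ} (γ : ℝ) (B : ℝ → ℝ) (ε : ℝ) (Ω : Set (E n))
    (φ u : E n → ℝ) : Prop where
  continuousOn : ContinuousOn u (closure Ω)
  boundary : EqOn u φ (frontier Ω)
  sol : IsViscositySol (penalizedRHS γ B ε) Ω u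
  nonneg : ∀ x ∈ closure Ω, 0 ≤ u x
  least : ∀ w : E n → ℝ, IsPenalizedSuper γ B ε Ω φ w → ∀ x ∈ closure Ω, u x ≤ w x

/-- Nonnegative boundary data of class `W^{2,∞}(∂Ω)`: the restriction to `∂Ω` is nonnegative and
extends to a `C^{1,1}` function on `ℝⁿ`. -/
def IsBoundaryDatum {n : ℕ} (Ω : Set (E n)) (φ : E n → ℝ) : Prop :=
  (∀ x ∈ frontier Ω, 0 ≤ φ x) ∧
    ∃ ψ : E n → ℝ, ContDiff ℝ 1 ψ ∧ (∃ K : NNReal, LipschitzWith K (fderiv ℝ ψ)) ∧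
      EqOn ψ φ (frontier Ω)

/-- `u ∈ C(closure Ω)` is the limit, as `ε → 0⁺`, of the minimal solutions `uε ε` of the penalized
problems with boundary data `φε ε → φ`. -/
structure IsLimitOfMinimal {n : ℕ} (γ : ℝ) (B : ℝ → ℝ) (Ω : Set (E n)) (φ : E n → ℝ)
    (φε uε : ℝ → E n → ℝ) (u : E n → ℝ) : Prop where
  datum : ∀ ε, 0 < ε → IsBoundaryDatum Ω (φε ε)
  datum_tendsto : TendstoUniformlyOn φε φ (𝓝[>] 0) (frontier Ω)
  minimal : ∀ ε, 0 < ε → IsMinimalSol γ B ε Ω (φε ε) (uε ε)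
  tendsto : TendstoLocallyUniformlyOn uε u (𝓝[>] 0) Ω
  continuousOn : ContinuousOn u (closure Ω)
  boundary : EqOn u φ (frontier Ω)

/-- Limiting solutions of the free boundary problem. -/
def IsLimitingSol {n : ℕ} (γ : ℝ) (B : ℝ → ℝ) (Ω : Set (E n)) (φ u : E n → ℝ) : Prop :=
  ∃ φε uε : ℝ → E n → ℝ, IsLimitOfMinimal γ B Ω φ φε uε u

/-- Nonnegative viscosity solutions of the free boundary problem
`Δ_∞ u = u^(-γ)` in `Ω ∩ {u > 0}`, `u = φ` on `∂Ω`. -/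
structure IsFreeBoundarySol {n : ℕ} (γ : ℝ) (Ω : Set (E n)) (φ u : E n → ℝ) : Prop where
  continuousOn : ContinuousOn u (closure Ω)
  nonneg : ∀ x ∈ closure Ω, 0 ≤ u x
  sol : IsViscositySol (fun s => s ^ (-γ)) (Ω ∩ {x | 0 < u x}) u
  boundary : EqOn u φ (frontier Ω)

/-- The free boundary `∂{u > 0} ∩ Ω`; the set `{u > 0}` is taken in `Ω`. -/
def freeBoundary {n : ℕ} (Ω : Set (E n)) (u : E n → ℝ) : Set (E n) :=
  frontier {x | x ∈ Ω ∧ 0 < u x} ∩ Ω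

/-- `u` is of class `C^{1,β}` at the point `x`: near `x` it differs from an affine function by at
most a multiple of `|y - x|^(1+β)`. -/
def IsC1HolderAt {n : ℕ} (β : ℝ) (u : E n → ℝ) (x : E n) : Prop :=
  ∃ p : E n →L[ℝ] ℝ, ∃ K r : ℝ, 0 < r ∧
    ∀ y ∈ Metric.ball x r, |u y - u x - p (y - x)| ≤ K * ‖y - x‖ ^ (1 + β)

/-- The radial profile `ω(x) = C_α |x|^α`. -/
def omega {n : ℕ} (γ : ℝ) (x : E n) : ℝ := radialConst γ * ‖x‖ ^ alpha γ

/-- The shifted radial profiles `ω_ε(x) = C_α (|x| + ε)^α`. -/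
def omegaShift {n : ℕ} (γ ε : ℝ) (x : E n) : ℝ := radialConst γ * (‖x‖ + ε) ^ alpha γ

end

end SingInf

/-!
For a radial function `g(|x|)` the equation `Δ_∞ u = f(u)` reads `(g')² g'' = f(g)`, that is
`P' = 3 f(g)` with `P = (g')³`. A profile with `P(0) = q > 0` and right-hand side `f + η`, `η > 0`,
cannot touch a viscosity supersolution from below: away from the origin it is a strict test
function, and at the origin it has a convex kink. Raising the initial value `g(0)` from below the
range of a supersolution `w` until `g` first attains the boundary value of `w` therefore gives a
strict profile below `w`; letting `q = η → 0` produces the minimal solution of `(P_ε)`, which is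
radial.

It is trapped between two functions that both converge to `ω`. Since `f(s) ≤ s ^ (-γ)`, the energy
inequality for `P ^ (4 / 3)` shows that `(g / C_α) ^ (1 / α)` has slope at most `1`, which bounds
`g` from below by its boundary value. With `C_α h ^ α = δ ε ^ α` the function
`C_α ((|x| + h) ^ α - α h ^ (α - 1) |x|)` is a supersolution of `(P_ε)`, which bounds `g` from above
by `C_α (|x| + h) ^ α`.
-/

namespace SingInf

section RealAnalysis

theorem second_deriv_nonneg_of_isLocalMin {ψ ψ' : ℝ → ℝ} {a x : ℝ}
    (hψ : ∀ᶠ t in 𝓝 x, HasDerivAt ψ (ψ' t) t) (hψ' : HasDerivAt ψ' a x)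
    (hmin : IsLocalMin ψ x) : 0 ≤ a := by
  by_contra! ha
  have hderiv : deriv ψ =ᶠ[𝓝 x] ψ' := hψ.mono fun t ht => ht.deriv
  have hderiv2 : deriv (deriv ψ) x = a := by rw [hderiv.deriv_eq, hψ'.deriv]
  have hmax : IsLocalMax ψ x :=
    isLocalMax_of_deriv_deriv_neg (by rwa [hderiv2]) hmin.deriv_eq_zero
      hψ.self_of_nhds.continuousAt
  have hconst : ψ =ᶠ[𝓝 x] fun _ => ψ x := by
    filter_upwards [hmin, hmax] with t ht1 ht2 using le_antisymm ht2 ht1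
  have hderiv_zero : deriv ψ =ᶠ[𝓝 x] fun _ => 0 := by
    filter_upwards [hconst.eventuallyEq_nhds] with t ht
    rw [ht.deriv_eq, deriv_const]
  rw [hderiv_zero.deriv_eq, deriv_const] at hderiv2
  exact ha.ne hderiv2.symm

theorem sub_le_sub_of_hasDerivWithinAt_le {f f' g g' : ℝ → ℝ} {a b : ℝ}
    (hf : ∀ t ∈ Icc a b, HasDerivWithinAt f (f' t) (Icc a b) t)
    (hg : ∀ t ∈ Icc a b, HasDerivWithinAt g (g' t) (Icc a b) t)
    (hle : ∀ t ∈ Icc a b, f' t ≤ g' t) {r s : ℝ} (hr : r ∈ Icc a b) (hs : s ∈ Icc a b)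
    (hrs : r ≤ s) : f s - f r ≤ g s - g r := by
  have hmono : MonotoneOn (fun t => g t - f t) (Icc a b) :=
    monotoneOn_of_hasDerivWithinAt_nonneg (convex_Icc a b)
      (fun t ht => ((hg t ht).sub (hf t ht)).continuousWithinAt)
      (fun t ht => ((hg t (interior_subset ht)).sub (hf t (interior_subset ht))).mono
        interior_subset)
      (fun t ht => sub_nonneg.mpr (hle t (interior_subset ht)))
  linarith [hmono hr hs hrs]

theorem lipschitzOnWith_rpow_const_Ici {a p : ℝ} (ha : 0 < a) (hp : p ≤ 1) :
    LipschitzOnWith (|p| * a ^ (p - 1)).toNNReal (fun x : ℝ => x ^ p) (Ici a) := by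
  refine (convex_Ici a).lipschitzOnWith_of_nnnorm_hasDerivWithin_le
    (f' := fun x => p * x ^ (p - 1)) (fun x hx =>
      (Real.hasDerivAt_rpow_const (Or.inl (ha.trans_le hx).ne')).hasDerivWithinAt) ?_
  intro x hx
  have hx0 : 0 < x := ha.trans_le hx
  rw [← NNReal.coe_le_coe, Real.coe_toNNReal _ (by positivity), coe_nnnorm, norm_mul,
    Real.norm_eq_abs, Real.norm_of_nonneg (by positivity)]
  exact mul_le_mul_of_nonneg_left (Real.rpow_le_rpow_of_nonpos ha hx (by linarith))
    (abs_nonneg p)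

theorem exists_first_eq {F : ℝ → ℝ} (hF : Continuous F) {T : ℝ} (hlow : ∀ v, v ≤ F v)
    (hup : ∀ v, F v ≤ v + T) (c : ℝ) : ∃ v ∈ Icc (c - T) c, F v = c ∧ ∀ v' < v, F v' < c := by
  have hbdd : BddBelow {v | c ≤ F v} := ⟨c - T, fun v (hv : c ≤ F v) => by linarith [hup v]⟩
  obtain ⟨hmem, hleast⟩ := (isClosed_le continuous_const hF).isLeast_csInf ⟨c, hlow c⟩ hbdd
  set v := sInf {v | c ≤ F v}
  have hbelow : ∀ v' < v, F v' < c := fun v' hv' => by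
    by_contra! hc
    exact (hleast hc).not_gt hv'
  have hle : F v ≤ c := le_of_tendsto (hF.continuousWithinAt (s := Iio v) (x := v))
    (eventually_mem_nhdsWithin.mono fun v' hv' => (hbelow v' hv').le)
  exact ⟨v, ⟨by linarith [hup v, show c ≤ F v from hmem], hleast (hlow c)⟩, hle.antisymm hmem,
    hbelow⟩

theorem lt_of_forall_not_touching {X : Type*} [TopologicalSpace X] [T2Space X] {K : Set X}
    (hK : IsCompact K) {F : ℝ → X → ℝ} {w : X → ℝ} {a b : ℝ}
    (hcont : ContinuousOn (fun p : ℝ × X => F p.1 p.2 - w p.2) (Icc a b ×ˢ K))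
    (ha : ∀ x ∈ K, F a x < w x)
    (htouch : ∀ v ∈ Ioc a b, (∀ y ∈ K, F v y ≤ w y) → ∀ x ∈ K, F v x ≠ w x)
    {v : ℝ} (hv : v ∈ Icc a b) {x : X} (hx : x ∈ K) : F v x < w x := by
  by_contra! hcross
  have hcompact : IsCompact (Icc a b ×ˢ K) := isCompact_Icc.prod hK
  have hcrossings : IsCompact
      ((Icc a b ×ˢ K) ∩ (fun p : ℝ × X => F p.1 p.2 - w p.2) ⁻¹' Ici 0) :=
    hcompact.of_isClosed_subset
      (hcont.preimage_isClosed_of_isClosed hcompact.isClosed isClosed_Ici) inter_subset_left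
  obtain ⟨⟨v₁, x₁⟩, ⟨⟨hv₁, hx₁⟩, hcross₁⟩, hfirst⟩ :=
    hcrossings.exists_isMinOn ⟨(v, x), ⟨hv, hx⟩, sub_nonneg.mpr hcross⟩
      (f := Prod.fst) continuousOn_fst
  replace hcross₁ : w x₁ ≤ F v₁ x₁ := sub_nonneg.mp hcross₁
  have hav₁ : a < v₁ := hv₁.1.lt_of_ne fun h => (ha x₁ hx₁).not_ge (h ▸ hcross₁)
  have hbelow : ∀ y ∈ K, F v₁ y ≤ w y := by
    intro y hy
    have hlim : ContinuousWithinAt (fun v => F v y - w y) (Ico a v₁) v₁ :=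
      (hcont.comp (f := fun v => (v, y)) (by fun_prop)
        (fun v hv => ⟨hv, hy⟩) v₁ hv₁).mono fun v hv => ⟨hv.1, hv.2.le.trans hv₁.2⟩
    have := right_nhdsWithin_Ico_neBot hav₁
    refine sub_nonpos.mp (le_of_tendsto hlim (eventually_mem_nhdsWithin.mono fun v hv => ?_))
    by_contra! hlt
    exact hv.2.not_ge (hfirst (a := (v, y)) ⟨⟨⟨hv.1, hv.2.le.trans hv₁.2⟩, hy⟩, hlt.le⟩)
  exact htouch v₁ ⟨hav₁, hv₁.2⟩ hbelow x₁ hx₁ ((hbelow x₁ hx₁).antisymm hcross₁)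

theorem lipschitzWith_mul_of_abs_le {X : Type*} [PseudoMetricSpace X] {u v : X → ℝ}
    {K L M N : NNReal} (hu : LipschitzWith K u) (hv : LipschitzWith L v) (hM : ∀ x, |u x| ≤ M)
    (hN : ∀ x, |v x| ≤ N) : LipschitzWith (M * L + N * K) fun x => u x * v x := by
  refine LipschitzWith.of_dist_le_mul fun x y => ?_
  calc |u x * v x - u y * v y| = |u x * (v x - v y) + v y * (u x - u y)| := by ring_nf
    _ ≤ |u x| * |v x - v y| + |v y| * |u x - u y| := by
        simpa only [abs_mul] using abs_add_le (u x * (v x - v y)) (v y * (u x - u y))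
    _ ≤ M * (L * dist x y) + N * (K * dist x y) := by
        gcongr
        exacts [hM x, hv.dist_le_mul x y, hN y, hu.dist_le_mul x y]
    _ = ↑(M * L + N * K) * dist x y := by
        push_cast
        ring

end RealAnalysis

section Trajectories

variable {F : Type*} [NormedAddCommGroup F] [NormedSpace ℝ F]

theorem exists_trajectory_of_lipschitz_of_bounded [CompleteSpace F] {X : F → F} {K L : NNReal}
    (hK : LipschitzWith K X) (hL : ∀ z, ‖X z‖ ≤ L) {ρ : ℝ} (hρ : 0 ≤ ρ) (z₀ : F) :
    ∃ z : ℝ → F, z 0 = z₀ ∧ ∀ t ∈ Icc 0 ρ, HasDerivWithinAt z (X (z t)) (Icc 0 ρ) t := by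
  have hPL : IsPicardLindelof (fun _ => X) (tmin := 0) (tmax := ρ) ⟨0, left_mem_Icc.mpr hρ⟩ z₀
      (L * ⟨ρ, hρ⟩) 0 L K :=
    { lipschitzOnWith := fun t _ => hK.lipschitzOnWith
      continuousOn := fun x _ => continuousOn_const
      norm_le := fun t _ x _ => hL x
      mul_max_le := by
        simp only [sub_zero, sub_self, NNReal.coe_zero]
        rw [max_eq_left hρ]
        exact le_rfl }
  exact hPL.exists_eq_forall_mem_Icc_hasDerivWithinAt₀

theorem dist_le_of_trajectories {X : F → F} {K : NNReal} (hK : LipschitzWith K X) {a b : ℝ}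
    {y z : ℝ → F} (hy : ∀ t ∈ Icc a b, HasDerivWithinAt y (X (y t)) (Icc a b) t)
    (hz : ∀ t ∈ Icc a b, HasDerivWithinAt z (X (z t)) (Icc a b) t) {t : ℝ} (ht : t ∈ Icc a b) :
    dist (y t) (z t) ≤ dist (y a) (z a) * Real.exp (K * (t - a)) := by
  have hright : ∀ {y : ℝ → F}, (∀ t ∈ Icc a b, HasDerivWithinAt y (X (y t)) (Icc a b) t) →
      ∀ t ∈ Ico a b, HasDerivWithinAt y (X (y t)) (Ici t) t := fun hy t ht =>
    (hy t (Ico_subset_Icc_self ht)).mono_of_mem_nhdsWithin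
      (mem_of_superset (Icc_mem_nhdsGE ht.2) (Icc_subset_Icc_left ht.1))
  exact dist_le_of_trajectories_ODE (fun _ => hK) (fun t ht => (hy t ht).continuousWithinAt)
    (hright hy) (fun t ht => (hz t ht).continuousWithinAt) (hright hz) le_rfl t ht

theorem exists_subseq_tendsto_of_lipschitzOnWith {G : Type*} [MetricSpace G] [ProperSpace G]
    {a b : ℝ} {L : NNReal} {y₀ : G} {C : ℝ} {z : ℕ → ℝ → G}
    (hL : ∀ k, LipschitzOnWith L (z k) (Icc a b))
    (hC : ∀ k, ∀ t ∈ Icc a b, z k t ∈ Metric.closedBall y₀ C) :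
    ∃ (φ : ℕ → ℕ) (y : ℝ → G), StrictMono φ ∧ LipschitzOnWith L y (Icc a b) ∧
      ∀ t ∈ Icc a b, Tendsto (fun k => z (φ k) t) atTop (𝓝 (y t)) := by
  let A : Set (BoundedContinuousFunction (Icc a b) G) :=
    {u | LipschitzWith L u ∧ ∀ t, u t ∈ Metric.closedBall y₀ C}
  have hAclosed : IsClosed A := by
    have hA : A = (⋂ t, ⋂ s, {u | dist (u t) (u s) ≤ L * dist t s}) ∩
        ⋂ t, {u | u t ∈ Metric.closedBall y₀ C} := by
      ext u
      simp only [A, lipschitzWith_iff_dist_le_mul, mem_ofPred_eq, mem_inter_iff, mem_iInter]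
    rw [hA]
    exact (isClosed_iInter fun t => isClosed_iInter fun s => isClosed_le
      ((continuous_eval_const t).dist (continuous_eval_const s)) continuous_const).inter
      (isClosed_iInter fun t => Metric.isClosed_closedBall.preimage (continuous_eval_const t))
  have hA : IsCompact A :=
    BoundedContinuousFunction.arzela_ascoli₂ (Metric.closedBall y₀ C)
      (isCompact_closedBall _ _) A hAclosed (fun u t hu => hu.2 t)
      (LipschitzWith.uniformEquicontinuous (K := L) _ fun u => u.2.1).equicontinuous
  let u : ℕ → BoundedContinuousFunction (Icc a b) G := fun k =>
    BoundedContinuousFunction.mkOfCompact ⟨(Icc a b).domRestrict (z k),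
      (hL k).continuousOn.domRestrict⟩
  have hu : ∀ k, u k ∈ A := fun k => ⟨(hL k).to_restrict, fun t => hC k t t.2⟩
  obtain ⟨w, -, φ, hφ, hlim⟩ := hA.tendsto_subseq hu
  have hw : ∀ t (ht : t ∈ Icc a b), Tendsto (fun k => z (φ k) t) atTop (𝓝 (w ⟨t, ht⟩)) :=
    fun t ht => ((continuous_eval_const (⟨t, ht⟩ : Icc a b)).tendsto w).comp hlim
  have hex : ∀ t, ∃ y, t ∈ Icc a b → Tendsto (fun k => z (φ k) t) atTop (𝓝 y) := fun t => by
    by_cases ht : t ∈ Icc a b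
    · exact ⟨_, fun _ => hw t ht⟩
    · exact ⟨y₀, fun h => absurd h ht⟩
  choose y hy using hex
  exact ⟨φ, y, hφ, LipschitzOnWith.of_dist_le_mul fun s hs t ht =>
    le_of_tendsto' ((hy s hs).dist (hy t ht)) fun k => (hL (φ k)).dist_le_mul s hs t ht, hy⟩

theorem hasDerivWithinAt_of_tendsto_trajectory [CompleteSpace F] {X : F → F} (hX : Continuous X)
    {e : ℕ → F} (he : Tendsto e atTop (𝓝 0)) {a b M : ℝ} {z : ℕ → ℝ → F}
    (hz : ∀ k, ∀ t ∈ Icc a b, HasDerivWithinAt (z k) (X (z k t) + e k) (Icc a b) t)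
    (hM : ∀ k, ∀ t ∈ Icc a b, ‖X (z k t) + e k‖ ≤ M) {y : ℝ → F} (hy : ContinuousOn y (Icc a b))
    (hlim : ∀ t ∈ Icc a b, Tendsto (fun k => z k t) atTop (𝓝 (y t))) {t : ℝ}
    (ht : t ∈ Icc a b) : HasDerivWithinAt y (X (y t)) (Icc a b) t := by
  have hpicard : ∀ k, ∀ t ∈ Icc a b, z k t = z k a + ∫ s in a..t, (X (z k s) + e k) := by
    intro k t ht
    have hsub : uIcc a t ⊆ Icc a b := by
      rw [uIcc_of_le ht.1]
      exact Icc_subset_Icc_right ht.2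
    rw [← ODE.picard_apply (f := fun _ x => X x + e k),
      ODE.picard_eq_of_hasDerivAt (u := univ) (by fun_prop)
        (fun s hs => (hz k s (hsub hs)).mono hsub) (mapsTo_univ _ _)]
  have hintegral : ∀ t ∈ Icc a b, y t = y a + ∫ s in a..t, X (y s) := by
    intro t ht
    have hsub : ∀ s ∈ uIoc a t, s ∈ Icc a b := fun s hs => by
      rw [uIoc_of_le ht.1] at hs
      exact ⟨hs.1.le, hs.2.trans ht.2⟩
    have hcont : ∀ k, ContinuousOn (fun t => X (z k t) + e k) (Icc a b) := fun k =>
      (hX.comp_continuousOn fun t ht => (hz k t ht).continuousWithinAt).add continuousOn_const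
    refine tendsto_nhds_unique ((hlim t ht).congr fun k => hpicard k t ht)
      ((hlim a ⟨le_rfl, ht.1.trans ht.2⟩).add ?_)
    refine intervalIntegral.tendsto_integral_filter_of_dominated_convergence (fun _ => M)
      (.of_forall fun k => ((hcont k).mono hsub).aestronglyMeasurable measurableSet_uIoc)
      (.of_forall fun k => .of_forall fun s hs => hM k s (hsub s hs))
      intervalIntegrable_const (.of_forall fun s hs => ?_)
    simpa using ((hX.tendsto _).comp (hlim s (hsub s hs))).add he
  refine (ODE.hasDerivWithinAt_picard_Icc (f := fun _ => X) (u := univ) (x₀ := y a)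
    ⟨le_rfl, ht.1.trans ht.2⟩ (hX.comp_continuousOn continuousOn_snd) hy
    (fun _ _ => mem_univ _) ht).congr (fun s hs => ?_) ?_
  · rw [hintegral s hs, ODE.picard_apply]
  · rw [hintegral t ht, ODE.picard_apply]

theorem exists_subseq_tendsto_trajectory [ProperSpace F] {X : F → F} (hX : Continuous X)
    {e : ℕ → F} (he : Tendsto e atTop (𝓝 0)) {a b : ℝ} {z : ℕ → ℝ → F}
    (hz : ∀ k, ∀ t ∈ Icc a b, HasDerivWithinAt (z k) (X (z k t) + e k) (Icc a b) t)
    {C : ℝ} (hC : ∀ k, ∀ t ∈ Icc a b, ‖z k t‖ ≤ C) :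
    ∃ (φ : ℕ → ℕ) (y : ℝ → F), StrictMono φ ∧
      (∀ t ∈ Icc a b, HasDerivWithinAt y (X (y t)) (Icc a b) t) ∧
      ∀ t ∈ Icc a b, Tendsto (fun k => z (φ k) t) atTop (𝓝 (y t)) := by
  obtain ⟨M, hM⟩ := (isCompact_closedBall (0 : F) C).exists_bound_of_continuousOn hX.continuousOn
  obtain ⟨N, hN⟩ := (Metric.isBounded_range_of_tendsto e he).exists_norm_le
  have hderiv_le : ∀ k, ∀ t ∈ Icc a b, ‖X (z k t) + e k‖ ≤ M + N := fun k t ht =>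
    (norm_add_le _ _).trans (add_le_add (hM _ (mem_closedBall_zero_iff.mpr (hC k t ht)))
      (hN _ (mem_range_self k)))
  obtain ⟨φ, y, hφ, hyLip, hlim⟩ := exists_subseq_tendsto_of_lipschitzOnWith (y₀ := 0) (C := C)
    (fun k => (convex_Icc a b).lipschitzOnWith_of_nnnorm_hasDerivWithin_le (C := (M + N).toNNReal)
      (hz k) fun t ht => NNReal.coe_le_coe.mp ((hderiv_le k t ht).trans (Real.le_coe_toNNReal _)))
    (fun k t ht => mem_closedBall_zero_iff.mpr (hC k t ht))
  exact ⟨φ, y, hφ, fun t ht => hasDerivWithinAt_of_tendsto_trajectory hX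
    (he.comp hφ.tendsto_atTop) (fun k => hz (φ k)) (fun k => hderiv_le (φ k))
    hyLip.continuousOn hlim ht, hlim⟩

end Trajectories

section SecondOrderTest

variable {F : Type*} [NormedAddCommGroup F] [NormedSpace ℝ F] {u φ : F → ℝ} {x : F}

theorem hasDerivAt_line (x e : F) (t : ℝ) : HasDerivAt (fun t : ℝ => x + t • e) e t := by
  simpa using ((hasDerivAt_id t).smul_const e).const_add x

theorem tendsto_line (x e : F) : Tendsto (fun t : ℝ => x + t • e) (𝓝 0) (𝓝 x) := by
  simpa using (hasDerivAt_line x e 0).continuousAt.tendsto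

theorem eventually_hasDerivAt_comp_line (hφ : ContDiffAt ℝ 2 φ x) (e : F) :
    ∀ᶠ t in 𝓝 (0 : ℝ),
      HasDerivAt (fun t : ℝ => φ (x + t • e)) (fderiv ℝ φ (x + t • e) e) t := by
  have hdiff : ∀ᶠ y in 𝓝 x, DifferentiableAt ℝ φ y :=
    (hφ.eventually (by simp)).mono fun y hy => hy.differentiableAt (by norm_num)
  filter_upwards [(tendsto_line x e).eventually hdiff] with t ht
  exact ht.hasFDerivAt.comp_hasDerivAt t (hasDerivAt_line x e t)

theorem hasDerivAt_fderiv_comp_line (hφ : ContDiffAt ℝ 2 φ x) (e : F) :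
    HasDerivAt (fun t : ℝ => fderiv ℝ φ (x + t • e) e) (fderiv ℝ (fderiv ℝ φ) x e e) 0 := by
  have hdiff : DifferentiableAt ℝ (fderiv ℝ φ) (x + (0 : ℝ) • e) := by
    simpa using (hφ.fderiv_right (m := 1) (by norm_num)).differentiableAt (by norm_num)
  have hcomp := hdiff.hasFDerivAt.comp_hasDerivAt 0 (hasDerivAt_line x e 0)
  have happly := hcomp.clm_apply (hasDerivAt_const (0 : ℝ) e)
  simpa using happly

theorem fderiv_eq_of_isLocalExtr_sub {u' : F →L[ℝ] ℝ} (hu : HasFDerivAt u u' x)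
    (hφ : DifferentiableAt ℝ φ x) (h : IsLocalExtr (fun y => u y - φ y) x) :
    fderiv ℝ φ x = u' :=
  (sub_eq_zero.mp (h.hasFDerivAt_eq_zero (hu.sub hφ.hasFDerivAt))).symm

theorem second_fderiv_le_of_isLocalMax_sub (hu : ContDiffAt ℝ 2 u x) (hφ : ContDiffAt ℝ 2 φ x)
    (h : IsLocalMax (fun y => u y - φ y) x) (e : F) :
    fderiv ℝ (fderiv ℝ u) x e e ≤ fderiv ℝ (fderiv ℝ φ) x e e := by
  have hmin : IsLocalMin (fun t : ℝ => φ (x + t • e) - u (x + t • e)) 0 := by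
    filter_upwards [(tendsto_line x e).eventually h] with t ht
    simp only [zero_smul, add_zero]
    linarith
  refine sub_nonneg.mp (second_deriv_nonneg_of_isLocalMin ?_
    ((hasDerivAt_fderiv_comp_line hφ e).sub (hasDerivAt_fderiv_comp_line hu e)) hmin)
  filter_upwards [eventually_hasDerivAt_comp_line hφ e, eventually_hasDerivAt_comp_line hu e]
    with t hφt hut using hφt.sub hut

theorem second_fderiv_eq_of_line (hφ : ContDiffAt ℝ 2 φ x) {e : F} {k k' : ℝ → ℝ} {a : ℝ}
    (hline : (fun t : ℝ => φ (x + t • e)) =ᶠ[𝓝 0] k) (hk : ∀ᶠ t in 𝓝 0, HasDerivAt k (k' t) t)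
    (hk' : HasDerivAt k' a 0) : fderiv ℝ (fderiv ℝ φ) x e e = a := by
  refine ((hasDerivAt_fderiv_comp_line hφ e).congr_of_eventuallyEq ?_).unique hk'
  filter_upwards [eventually_hasDerivAt_comp_line hφ e, hk, hline.eventuallyEq_nhds]
    with t hφt hkt ht using hkt.unique (hφt.congr_of_eventuallyEq ht.symm)

end SecondOrderTest

section InfLaplacian

variable {n : ℕ} {u φ : E n → ℝ} {x : E n}

theorem infLaplacian_of_fderiv_eq {e : E n} {p : ℝ} (h : fderiv ℝ φ x = p • innerSL ℝ e) :
    infLaplacian φ x = p ^ 2 * fderiv ℝ (fderiv ℝ φ) x e e := by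
  have hgrad : gradient φ x = p • e := by
    rw [gradient, h]
    apply (InnerProductSpace.toDual ℝ (E n)).injective
    ext y
    simp
  simp only [infLaplacian, hgrad, map_smul, smul_apply, smul_eq_mul]
  ring

theorem infLaplacian_eq_zero_of_isLocalExtr_sub (hu : HasFDerivAt u (0 : E n →L[ℝ] ℝ) x)
    (hφ : DifferentiableAt ℝ φ x) (h : IsLocalExtr (fun y => u y - φ y) x) :
    infLaplacian φ x = 0 := by
  rw [infLaplacian_of_fderiv_eq (e := 0) (p := 0)
    ((fderiv_eq_of_isLocalExtr_sub hu hφ h).trans (zero_smul ℝ _).symm)]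
  simp

theorem infLaplacian_le_of_isLocalMax_sub (hu : ContDiffAt ℝ 2 u x) (hφ : ContDiffAt ℝ 2 φ x)
    (h : IsLocalMax (fun y => u y - φ y) x) : infLaplacian u x ≤ infLaplacian φ x := by
  have hgrad : gradient φ x = gradient u x := by
    rw [gradient, gradient, fderiv_eq_of_isLocalExtr_sub
      (hu.differentiableAt (by norm_num)).hasFDerivAt (hφ.differentiableAt (by norm_num))
      (Or.inr h)]
  rw [infLaplacian, infLaplacian, hgrad]
  exact second_fderiv_le_of_isLocalMax_sub hu hφ h _

theorem infLaplacian_le_of_isLocalMin_sub (hu : ContDiffAt ℝ 2 u x) (hφ : ContDiffAt ℝ 2 φ x)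
    (h : IsLocalMin (fun y => u y - φ y) x) : infLaplacian φ x ≤ infLaplacian u x :=
  infLaplacian_le_of_isLocalMax_sub hφ hu (by simpa using h.neg)

theorem isViscositySol_of_contDiffAt {G : ℝ → ℝ} {Ω : Set (E n)}
    (hu : ∀ x ∈ Ω, ContDiffAt ℝ 2 u x) (heq : ∀ x ∈ Ω, infLaplacian u x = G (u x)) :
    IsViscositySol G Ω u := by
  have hcont : ContinuousOn u Ω := fun x hx => (hu x hx).continuousAt.continuousWithinAt
  refine ⟨⟨hcont, fun x hx φ hφ h => ?_⟩, hcont, fun x hx φ hφ h => ?_⟩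
  · exact heq x hx ▸ infLaplacian_le_of_isLocalMax_sub (hu x hx) hφ h
  · exact heq x hx ▸ infLaplacian_le_of_isLocalMin_sub (hu x hx) hφ h

theorem infLaplacian_quadratic {e : E n} (he : ‖e‖ = 1) (x : E n) (p M : ℝ) :
    infLaplacian (fun y => p * innerSL ℝ e (y - x) + M / 2 * innerSL ℝ e (y - x) ^ 2) x
      = p ^ 2 * M := by
  have hinner : HasFDerivAt (fun y : E n => innerSL ℝ e (y - x)) (innerSL ℝ e) x :=
    (innerSL ℝ e).hasFDerivAt.comp x ((hasFDerivAt_id x).sub_const x)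
  have hgrad : HasFDerivAt (fun y => p * innerSL ℝ e (y - x) + M / 2 * innerSL ℝ e (y - x) ^ 2)
      (p • innerSL ℝ e) x :=
    ((hinner.const_mul p).add ((hinner.pow 2).const_mul (M / 2))).congr_fderiv (by simp)
  rw [infLaplacian_of_fderiv_eq hgrad.fderiv]
  congr 1
  refine second_fderiv_eq_of_line (by fun_prop) (k := fun t => p * t + M / 2 * t ^ 2)
    (k' := fun t => p + M * t) (.of_forall fun t => by simp [he])
    (.of_forall fun t => ?_) (by simpa using ((hasDerivAt_id (0 : ℝ)).const_mul M).const_add p)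
  refine (((hasDerivAt_id t).const_mul p).add
    ((hasDerivAt_pow 2 t).const_mul (M / 2))).congr_deriv ?_
  norm_num
  ring

/- A convex kink leaves room for test functions with fixed slope and arbitrarily large
curvature. -/
theorem IsViscositySuper.not_kink {G : ℝ → ℝ} {Ω : Set (E n)} {w : E n → ℝ}
    (hw : IsViscositySuper G Ω w) {e : E n} (hx : x ∈ Ω) (he : ‖e‖ = 1) {p : ℝ} (hp : 0 < p) :
    ¬ ∀ᶠ y in 𝓝 x, p * |innerSL ℝ e (y - x)| ≤ w y - w x := by
  intro hkink
  obtain ⟨M, hM, hM0⟩ : ∃ M, G (w x) < (p / 2) ^ 2 * M ∧ 0 < M :=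
    (((tendsto_id.const_mul_atTop (by positivity)).eventually_gt_atTop _).and
      (eventually_gt_atTop 0)).exists
  have hinner : Tendsto (fun y : E n => |innerSL ℝ e (y - x)|) (𝓝 x) (𝓝 0) :=
    Continuous.tendsto' (by fun_prop) _ _ (by simp)
  refine hM.not_ge ((infLaplacian_quadratic he x _ M).symm.trans_le
    (hw.2 x hx _ (by fun_prop) ?_))
  filter_upwards [hkink, hinner.eventually (gt_mem_nhds (show 0 < p / M by positivity))]
    with y hy hsmall
  rw [lt_div_iff₀ hM0] at hsmall
  have hnonneg := abs_nonneg (innerSL ℝ e (y - x))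
  have hself := le_abs_self (innerSL ℝ e (y - x))
  have hsq : M / 2 * innerSL ℝ e (y - x) ^ 2 ≤ p / 2 * |innerSL ℝ e (y - x)| := by
    rw [← sq_abs]
    nlinarith
  simp only [sub_self, map_zero]
  nlinarith

end InfLaplacian

section Radial

variable {n : ℕ} {g g' : ℝ → ℝ} {a p : ℝ} {x : E n}

theorem hasFDerivAt_radial (hx : x ≠ 0) (hg : HasDerivAt g p ‖x‖) :
    HasFDerivAt (fun y : E n => g ‖y‖) (p • innerSL ℝ (‖x‖⁻¹ • x)) x := by
  have hnorm : HasFDerivAt (fun y : E n => ‖y‖) (innerSL ℝ (‖x‖⁻¹ • x)) x := by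
    have hsqrt := (hasStrictFDerivAt_norm_sq x).hasFDerivAt.sqrt (by simpa using hx)
    simp only [Real.sqrt_sq (norm_nonneg _)] at hsqrt
    refine hsqrt.congr_fderiv ?_
    ext y
    simp only [one_div, mul_inv_rev, smul_apply, nsmul_eq_mul,
      Nat.cast_ofNat, innerSL_apply_apply, smul_eq_mul, map_smul]
    ring
  exact hg.comp_hasFDerivAt x hnorm

theorem hasFDerivAt_radial_zero {ρ : ℝ} (hρ : 0 < ρ) (hg : HasDerivWithinAt g 0 (Icc 0 ρ) 0) :
    HasFDerivAt (fun x : E n => g ‖x‖) (0 : E n →L[ℝ] ℝ) 0 := by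
  have hnorm : Tendsto (fun x : E n => ‖x‖) (𝓝 0) (𝓝[Icc 0 ρ] 0) := by
    refine tendsto_nhdsWithin_iff.mpr ⟨by simpa using continuous_norm.tendsto (0 : E n), ?_⟩
    filter_upwards [Metric.ball_mem_nhds (0 : E n) hρ] with x hx
    exact ⟨norm_nonneg x, (mem_ball_zero_iff.mp hx).le⟩
  have hlittle := (hasDerivWithinAt_iff_isLittleO.mp hg).comp_tendsto hnorm
  simp only [Function.comp_def, sub_zero, smul_zero] at hlittle
  rw [hasFDerivAt_iff_isLittleO]
  simpa using hlittle.of_norm_right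

theorem contDiffAt_radial (hx : x ≠ 0) (hg : ContDiffAt ℝ 2 g ‖x‖) :
    ContDiffAt ℝ 2 (fun y : E n => g ‖y‖) x :=
  hg.comp x (contDiffAt_norm ℝ hx)

theorem infLaplacian_radial (hx : x ≠ 0) (hC2 : ContDiffAt ℝ 2 g ‖x‖)
    (hg : ∀ᶠ r in 𝓝 ‖x‖, HasDerivAt g (g' r) r) (hg' : HasDerivAt g' a ‖x‖) :
    infLaplacian (fun y : E n => g ‖y‖) x = g' ‖x‖ ^ 2 * a := by
  have hpos : 0 < ‖x‖ := norm_pos_iff.mpr hx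
  have hshift : Tendsto (fun t : ℝ => ‖x‖ + t) (𝓝 0) (𝓝 ‖x‖) :=
    Continuous.tendsto' (by fun_prop) _ _ (add_zero _)
  rw [infLaplacian_of_fderiv_eq (hasFDerivAt_radial hx hg.self_of_nhds).fderiv]
  congr 1
  refine second_fderiv_eq_of_line (contDiffAt_radial hx hC2) (k := fun t => g (‖x‖ + t))
    (k' := fun t => g' (‖x‖ + t)) ?_ ?_ (HasDerivAt.comp_const_add _ _ (by simpa using hg'))
  · filter_upwards [hshift.eventually (lt_mem_nhds hpos)] with t ht
    have hcollinear : x + t • (‖x‖⁻¹ • x) = ((‖x‖ + t) * ‖x‖⁻¹) • x := by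
      rw [add_mul, mul_inv_cancel₀ hpos.ne', add_smul, one_smul, mul_smul]
    rw [hcollinear, norm_smul, norm_mul, norm_inv, norm_norm, Real.norm_of_nonneg ht.le,
      inv_mul_cancel_right₀ hpos.ne']
  · filter_upwards [hshift.eventually hg] with t ht using HasDerivAt.comp_const_add _ _ ht

theorem contDiffAt_succ_of_hasDerivAt {m : ℕ} {r : ℝ} (hg : ∀ᶠ s in 𝓝 r, HasDerivAt g (g' s) s)
    (hg' : ContDiffAt ℝ m g' r) : ContDiffAt ℝ (m + 1) g r := by
  refine (contDiffAt_succ_iff_hasFDerivAt (n := m)).mpr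
    ⟨fun s => ContinuousLinearMap.toSpanSingletonCLE (𝕜 := ℝ) (g' s),
      ⟨_, hg, fun s hs => HasDerivAt.hasFDerivAt hs⟩, ?_⟩
  exact (ContinuousLinearEquiv.contDiff _).contDiffAt.comp r hg'

theorem contDiffAt_two_of_hasDerivAt {g'' : ℝ → ℝ} {r : ℝ}
    (hg : ∀ᶠ s in 𝓝 r, HasDerivAt g (g' s) s) (hg' : ∀ᶠ s in 𝓝 r, HasDerivAt g' (g'' s) s)
    (hcont : ∀ᶠ s in 𝓝 r, ContinuousAt g'' s) : ContDiffAt ℝ 2 g r := by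
  have hC0 : ContDiffAt ℝ 0 g'' r := contDiffAt_zero.mpr
    ⟨_, hcont, fun s hs => ContinuousAt.continuousWithinAt hs⟩
  have hC1 : ContDiffAt ℝ 1 g' r := by
    simpa using contDiffAt_succ_of_hasDerivAt (m := 0) hg' (by simpa using hC0)
  simpa [one_add_one_eq_two] using contDiffAt_succ_of_hasDerivAt (m := 1) hg (by simpa using hC1)

end Radial

section Profile

/-- A radial profile on `[0, ρ]` for the equation `(g')² g'' = f(g)`, written as a first-order
system in `g` and `P = (g')³`, which stays meaningful where `g'` vanishes. -/
structure IsProfile (f : ℝ → ℝ) (ρ : ℝ) (g P : ℝ → ℝ) : Prop where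
  deriv_val : ∀ r ∈ Icc 0 ρ, HasDerivWithinAt g (P r ^ (1 / 3 : ℝ)) (Icc 0 ρ) r
  deriv_slope : ∀ r ∈ Icc 0 ρ, HasDerivWithinAt P (3 * f (g r)) (Icc 0 ρ) r

namespace IsProfile

variable {f g P : ℝ → ℝ} {ρ r m M k : ℝ}

theorem mono (hp : IsProfile f ρ g P) (hr : r ≤ ρ) : IsProfile f r g P where
  deriv_val s hs := (hp.deriv_val s ⟨hs.1, hs.2.trans hr⟩).mono (Icc_subset_Icc_right hr)
  deriv_slope s hs := (hp.deriv_slope s ⟨hs.1, hs.2.trans hr⟩).mono (Icc_subset_Icc_right hr)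

theorem continuousOn_val (hp : IsProfile f ρ g P) : ContinuousOn g (Icc 0 ρ) :=
  fun r hr => (hp.deriv_val r hr).continuousWithinAt

theorem add_mul_le_slope (hp : IsProfile f ρ g P) (hm : ∀ t ∈ Icc 0 ρ, m ≤ f (g t))
    (hr : r ∈ Icc 0 ρ) : P 0 + 3 * m * r ≤ P r := by
  have hle := sub_le_sub_of_hasDerivWithinAt_le
    (fun t _ => ((hasDerivAt_id t).const_mul (3 * m)).hasDerivWithinAt) hp.deriv_slope
    (fun t ht => by linarith [hm t ht]) (left_mem_Icc.mpr (hr.1.trans hr.2)) hr hr.1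
  simp only [id] at hle
  linarith

theorem slope_le_add_mul (hp : IsProfile f ρ g P) (hM : ∀ t ∈ Icc 0 ρ, f (g t) ≤ M)
    (hr : r ∈ Icc 0 ρ) : P r ≤ P 0 + 3 * M * r := by
  have hle := sub_le_sub_of_hasDerivWithinAt_le hp.deriv_slope
    (fun t _ => ((hasDerivAt_id t).const_mul (3 * M)).hasDerivWithinAt)
    (fun t ht => by linarith [hM t ht]) (left_mem_Icc.mpr (hr.1.trans hr.2)) hr hr.1
  simp only [id] at hle
  linarith

theorem init_slope_le (hp : IsProfile f ρ g P) (h0 : ∀ s, 0 ≤ f s) (hr : r ∈ Icc 0 ρ) :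
    P 0 ≤ P r := by
  simpa using hp.add_mul_le_slope (fun t _ => h0 (g t)) hr

theorem add_mul_le_val (hp : IsProfile f ρ g P) (hk : 0 ≤ k) (hP : ∀ t ∈ Icc 0 ρ, k ≤ P t)
    (hr : r ∈ Icc 0 ρ) : g 0 + k ^ (1 / 3 : ℝ) * r ≤ g r := by
  have hle := sub_le_sub_of_hasDerivWithinAt_le
    (fun t _ => ((hasDerivAt_id t).const_mul (k ^ (1 / 3 : ℝ))).hasDerivWithinAt) hp.deriv_val
    (fun t ht => by simpa using Real.rpow_le_rpow hk (hP t ht) (by norm_num : (0 : ℝ) ≤ 1 / 3))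
    (left_mem_Icc.mpr (hr.1.trans hr.2)) hr hr.1
  simp only [id] at hle
  linarith

theorem val_le_add_mul (hp : IsProfile f ρ g P) (h0 : ∀ t ∈ Icc 0 ρ, 0 ≤ P t)
    (hP : ∀ t ∈ Icc 0 ρ, P t ≤ k) (hr : r ∈ Icc 0 ρ) : g r ≤ g 0 + k ^ (1 / 3 : ℝ) * r := by
  have hle := sub_le_sub_of_hasDerivWithinAt_le hp.deriv_val
    (fun t _ => ((hasDerivAt_id t).const_mul (k ^ (1 / 3 : ℝ))).hasDerivWithinAt)
    (fun t ht => by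
      simpa using Real.rpow_le_rpow (h0 t ht) (hP t ht) (by norm_num : (0 : ℝ) ≤ 1 / 3))
    (left_mem_Icc.mpr (hr.1.trans hr.2)) hr hr.1
  simp only [id] at hle
  linarith

theorem monotoneOn_val (hp : IsProfile f ρ g P) (h0 : ∀ s, 0 ≤ f s) (hP0 : 0 ≤ P 0) :
    MonotoneOn g (Icc 0 ρ) := fun r hr s hs hrs => by
  have hle := sub_le_sub_of_hasDerivWithinAt_le (f := fun _ => 0)
    (fun t _ => hasDerivWithinAt_const t _ 0) hp.deriv_val
    (fun t ht => Real.rpow_nonneg (hP0.trans (hp.init_slope_le h0 ht)) _) hr hs hrs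
  linarith

theorem slope_le_of_le (hp : IsProfile f ρ g P) (h0 : ∀ s, 0 ≤ f s) (hM : ∀ s, f s ≤ M)
    (hr : r ∈ Icc 0 ρ) : P r ≤ P 0 + 3 * M * ρ := by
  have hM0 : 0 ≤ M := (h0 0).trans (hM 0)
  have := hp.slope_le_add_mul (fun t _ => hM (g t)) hr
  nlinarith [mul_le_mul_of_nonneg_left hr.2 hM0]

theorem val_le_add (hp : IsProfile f ρ g P) (h0 : ∀ s, 0 ≤ f s) (hP0 : 0 ≤ P 0)
    (hM : ∀ s, f s ≤ M) (hr : r ∈ Icc 0 ρ) :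
    g r ≤ g 0 + (P 0 + 3 * M * ρ) ^ (1 / 3 : ℝ) * ρ := by
  have hnonneg : ∀ t ∈ Icc 0 ρ, 0 ≤ P t := fun t ht => hP0.trans (hp.init_slope_le h0 ht)
  have hle : ∀ t ∈ Icc 0 ρ, P t ≤ P 0 + 3 * M * ρ := fun t ht => hp.slope_le_of_le h0 hM ht
  refine (hp.val_le_add_mul hnonneg hle hr).trans ?_
  have := (hnonneg r hr).trans (hle r hr)
  gcongr
  exact hr.2

theorem hasDerivAt_val (hp : IsProfile f ρ g P) (hr : r ∈ Ioo 0 ρ) :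
    HasDerivAt g (P r ^ (1 / 3 : ℝ)) r :=
  (hp.deriv_val r (Ioo_subset_Icc_self hr)).hasDerivAt (Icc_mem_nhds hr.1 hr.2)

theorem hasDerivAt_slope (hp : IsProfile f ρ g P) (hr : r ∈ Ioo 0 ρ) :
    HasDerivAt P (3 * f (g r)) r :=
  (hp.deriv_slope r (Ioo_subset_Icc_self hr)).hasDerivAt (Icc_mem_nhds hr.1 hr.2)

theorem eventually_hasDerivAt_val (hp : IsProfile f ρ g P) (hr : r ∈ Ioo 0 ρ) :
    ∀ᶠ s in 𝓝 r, HasDerivAt g (P s ^ (1 / 3 : ℝ)) s := by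
  filter_upwards [Ioo_mem_nhds hr.1 hr.2] with s hs using hp.hasDerivAt_val hs

theorem hasDerivAt_cbrt_slope (hp : IsProfile f ρ g P) (hr : r ∈ Ioo 0 ρ) (hP : 0 < P r) :
    HasDerivAt (fun s => P s ^ (1 / 3 : ℝ)) (f (g r) * P r ^ (-(2 / 3) : ℝ)) r := by
  refine ((hp.hasDerivAt_slope hr).rpow_const (p := 1 / 3) (Or.inl hP.ne')).congr_deriv ?_
  rw [show (1 / 3 : ℝ) - 1 = -(2 / 3) by norm_num]
  ring

theorem contDiffAt_val (hp : IsProfile f ρ g P) (hf : Continuous f) (hr : r ∈ Ioo 0 ρ)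
    (hP : 0 < P r) : ContDiffAt ℝ 2 g r := by
  have hnear : ∀ᶠ s in 𝓝 r, s ∈ Ioo 0 ρ ∧ 0 < P s := Filter.Eventually.and
    (Ioo_mem_nhds hr.1 hr.2) ((hp.hasDerivAt_slope hr).continuousAt.eventually (lt_mem_nhds hP))
  refine contDiffAt_two_of_hasDerivAt (hp.eventually_hasDerivAt_val hr)
    (hnear.mono fun s hs => hp.hasDerivAt_cbrt_slope hs.1 hs.2) (hnear.mono fun s hs => ?_)
  exact (hf.continuousAt.comp (hp.hasDerivAt_val hs.1).continuousAt).mul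
    ((hp.hasDerivAt_slope hs.1).continuousAt.rpow_const (Or.inl hs.2.ne'))

theorem infLaplacian_eq (hp : IsProfile f ρ g P) (hf : Continuous f) {n : ℕ} {x : E n}
    (hx : x ≠ 0) (hxρ : ‖x‖ < ρ) (hP : 0 < P ‖x‖) :
    infLaplacian (fun y : E n => g ‖y‖) x = f (g ‖x‖) := by
  have hr : ‖x‖ ∈ Ioo 0 ρ := ⟨norm_pos_iff.mpr hx, hxρ⟩
  rw [infLaplacian_radial hx (hp.contDiffAt_val hf hr hP) (hp.eventually_hasDerivAt_val hr)
    (hp.hasDerivAt_cbrt_slope hr hP)]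
  have hsq : (P ‖x‖ ^ (1 / 3 : ℝ)) ^ 2 * P ‖x‖ ^ (-(2 / 3) : ℝ) = 1 := by
    rw [← Real.rpow_natCast, ← Real.rpow_mul hP.le, ← Real.rpow_add hP]
    norm_num
  rw [mul_left_comm, hsq, mul_one]

end IsProfile

end Profile

section ProfileFamily

/-- A family of profiles parametrized by the initial value, with common initial slope `q^(1/3)` and
Lipschitz dependence on the parameter. -/
structure IsProfileFamily (f : ℝ → ℝ) (q ρ : ℝ) (D : NNReal) (g P : ℝ → ℝ → ℝ) : Prop where
  isProfile : ∀ v, IsProfile f ρ (g v) (P v)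
  init_val : ∀ v, g v 0 = v
  init_slope : ∀ v, P v 0 = q
  lipschitz : ∀ r ∈ Icc 0 ρ, LipschitzWith D fun v => g v r

/-- The field of the first-order system for profiles, with the slope variable clamped to `[q, Q]`.
For `0 < q` this makes it globally Lipschitz and bounded. -/
noncomputable def clampedField (f : ℝ → ℝ) {q Q : ℝ} (h : q ≤ Q) (z : ℝ × ℝ) : ℝ × ℝ :=
  ((projIcc q Q h z.2 : ℝ) ^ (1 / 3 : ℝ), 3 * f z.1)

variable {f : ℝ → ℝ} {K : NNReal} {M q Q ρ : ℝ}

theorem exists_lipschitzWith_clampedField (hK : LipschitzWith K f) (hq : 0 < q) (h : q ≤ Q) :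
    ∃ K', LipschitzWith K' (clampedField f h) := by
  have hcbrt := (((lipschitzOnWith_rpow_const_Ici hq (show (1 / 3 : ℝ) ≤ 1 by norm_num)).mono
    Icc_subset_Ici_self).to_restrict.comp (LipschitzWith.projIcc h)).comp
    (LipschitzWith.prod_snd (α := ℝ))
  have hrhs := ((lipschitzWith_smul (3 : ℝ)).comp hK).comp (LipschitzWith.prod_fst (β := ℝ))
  exact ⟨_, hcbrt.prodMk hrhs⟩

theorem norm_clampedField_le (h0 : ∀ s, 0 ≤ f s) (hM : ∀ s, f s ≤ M) (hq : 0 < q) (h : q ≤ Q)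
    (z : ℝ × ℝ) : ‖clampedField f h z‖ ≤ max (Q ^ (1 / 3 : ℝ)) (3 * M) := by
  have hclamp := (projIcc q Q h z.2).2
  have hpos : 0 ≤ (projIcc q Q h z.2 : ℝ) := hq.le.trans hclamp.1
  refine max_le_max ?_ ?_
  · rw [clampedField, Real.norm_of_nonneg (Real.rpow_nonneg hpos _)]
    exact Real.rpow_le_rpow hpos hclamp.2 (by norm_num)
  · rw [clampedField, Real.norm_of_nonneg (by linarith [h0 z.1])]
    linarith [hM z.1]

theorem isProfile_of_clampedField (h0 : ∀ s, 0 ≤ f s) (hM : ∀ s, f s ≤ M)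
    (h : q ≤ q + 3 * M * ρ) {z : ℝ → ℝ × ℝ}
    (hz : ∀ t ∈ Icc 0 ρ, HasDerivWithinAt z (clampedField f h (z t)) (Icc 0 ρ) t)
    (hz0 : (z 0).2 = q) : IsProfile f ρ (fun t => (z t).1) (fun t => (z t).2) := by
  have hP : ∀ t ∈ Icc 0 ρ, HasDerivWithinAt (fun t => (z t).2) (3 * f (z t).1) (Icc 0 ρ) t :=
    fun t ht => (ContinuousLinearMap.snd ℝ ℝ ℝ).hasFDerivAt.comp_hasDerivWithinAt t (hz t ht)
  have hclamp : ∀ t ∈ Icc 0 ρ, (z t).2 ∈ Icc q (q + 3 * M * ρ) := fun t ht => by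
    have h0mem : (0 : ℝ) ∈ Icc 0 ρ := left_mem_Icc.mpr (ht.1.trans ht.2)
    have hlow := sub_le_sub_of_hasDerivWithinAt_le (f := fun _ => 0)
      (fun t _ => hasDerivWithinAt_const t _ 0) hP (fun t _ => by linarith [h0 (z t).1])
      h0mem ht ht.1
    have hup := sub_le_sub_of_hasDerivWithinAt_le hP
      (fun t _ => ((hasDerivAt_id t).const_mul (3 * M)).hasDerivWithinAt)
      (fun t _ => by linarith [hM (z t).1]) h0mem ht ht.1
    simp only [id] at hup
    have := mul_le_mul_of_nonneg_left ht.2 ((h0 0).trans (hM 0))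
    exact ⟨by linarith, by linarith⟩
  refine ⟨fun t ht => ((ContinuousLinearMap.fst ℝ ℝ ℝ).hasFDerivAt.comp_hasDerivWithinAt t
    (hz t ht)).congr_deriv ?_, hP⟩
  simp [clampedField, projIcc_of_mem h (hclamp t ht)]

theorem exists_isProfileFamily (hK : LipschitzWith K f) (h0 : ∀ s, 0 ≤ f s) (hM : ∀ s, f s ≤ M)
    (hq : 0 < q) (hρ : 0 ≤ ρ) : ∃ D g P, IsProfileFamily f q ρ D g P := by
  have hM0 : 0 ≤ M := (h0 0).trans (hM 0)
  have hqQ : q ≤ q + 3 * M * ρ := by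
    have : 0 ≤ 3 * M * ρ := by positivity
    linarith
  obtain ⟨K', hK'⟩ := exists_lipschitzWith_clampedField hK hq hqQ
  choose z hz0 hz using fun v => exists_trajectory_of_lipschitz_of_bounded hK'
    (L := ⟨_, le_max_of_le_right (by positivity)⟩) (norm_clampedField_le h0 hM hq hqQ) hρ (v, q)
  refine ⟨(Real.exp (K' * ρ)).toNNReal, fun v t => (z v t).1, fun v t => (z v t).2,
    fun v => isProfile_of_clampedField h0 hM hqQ (hz v) (by rw [hz0]), fun v => by simp [hz0],
    fun v => by simp [hz0], fun r hr => LipschitzWith.of_dist_le_mul fun v v' => ?_⟩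
  rw [Real.coe_toNNReal _ (Real.exp_pos _).le]
  calc dist (z v r).1 (z v' r).1 ≤ dist (z v r) (z v' r) := le_max_left _ _
    _ ≤ dist (z v 0) (z v' 0) * Real.exp (K' * (r - 0)) :=
        dist_le_of_trajectories hK' (hz v) (hz v') hr
    _ = dist v v' * Real.exp (K' * r) := by simp [hz0, Prod.dist_eq]
    _ ≤ Real.exp (K' * ρ) * dist v v' := by
        rw [mul_comm]
        gcongr
        exact hr.2

end ProfileFamily

section Comparison

/-- Continuous viscosity supersolutions of `Δ_∞ w = f(w)` in the ball `B_R` with the constant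
boundary value `c`. -/
structure IsBallSuper {n : ℕ} (f : ℝ → ℝ) (R c : ℝ) (w : E n → ℝ) : Prop where
  continuousOn : ContinuousOn w (Metric.closedBall 0 R)
  boundary : ∀ x, ‖x‖ = R → w x = c
  super : IsViscositySuper f (Metric.ball 0 R) w

variable {n : ℕ} {f : ℝ → ℝ} {R c η q : ℝ}

theorem norm_mem_Icc_of_mem_closedBall {x : E n} (hx : x ∈ Metric.closedBall 0 R) :
    ‖x‖ ∈ Icc 0 R := ⟨norm_nonneg x, mem_closedBall_zero_iff.mp hx⟩

/- At the origin a profile with positive initial slope has a convex kink; elsewhere it is itself a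
test function. -/
theorem IsProfile.ne_of_le_super [NeZero n] {g P : ℝ → ℝ}
    (hp : IsProfile (fun s => f s + η) R g P) (hf : Continuous f) (h0 : ∀ s, 0 ≤ f s) (hη : 0 < η)
    (hP0 : 0 < P 0) {w : E n → ℝ} (hw : IsViscositySuper f (Metric.ball 0 R) w)
    (hle : ∀ y ∈ Metric.ball 0 R, g ‖y‖ ≤ w y) {x : E n} (hx : x ∈ Metric.ball 0 R) :
    g ‖x‖ ≠ w x := by
  intro heq
  have hpos : ∀ s, 0 ≤ f s + η := fun s => add_nonneg (h0 s) hη.le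
  have hball : ∀ᶠ y in 𝓝 x, y ∈ Metric.ball 0 R := Metric.isOpen_ball.mem_nhds hx
  rcases eq_or_ne x 0 with rfl | hne
  · obtain ⟨e, he⟩ := exists_norm_eq (E n) zero_le_one
    refine hw.not_kink hx he (Real.rpow_pos_of_pos hP0 (1 / 3)) ?_
    filter_upwards [hball] with y hy
    have hlow := hp.add_mul_le_val hP0.le (fun t ht => hp.init_slope_le hpos ht)
      (norm_mem_Icc_of_mem_closedBall (Metric.ball_subset_closedBall hy))
    have hinner : |innerSL ℝ e (y - 0)| ≤ ‖y‖ := by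
      simpa [he] using (innerSL ℝ e).le_opNorm y
    have := mul_le_mul_of_nonneg_left hinner (Real.rpow_nonneg hP0.le (1 / 3))
    rw [norm_zero] at heq
    linarith [hle y hy]
  · have hxR : ‖x‖ < R := mem_ball_zero_iff.mp hx
    have hP : 0 < P ‖x‖ := hP0.trans_le (hp.init_slope_le hpos ⟨norm_nonneg x, hxR.le⟩)
    have hC2 := hp.contDiffAt_val (by fun_prop) ⟨norm_pos_iff.mpr hne, hxR⟩ hP
    have htest := hw.2 x hx (fun y => g ‖y‖) (contDiffAt_radial hne hC2) (by
      filter_upwards [hball] with y hy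
      linarith [hle y hy])
    rw [hp.infLaplacian_eq (by fun_prop) hne hxR hP, heq] at htest
    linarith

namespace IsProfileFamily

variable {D : NNReal} {g P : ℝ → ℝ → ℝ}

theorem continuousOn_radial (hg : IsProfileFamily f q R D g P) (s : Set ℝ) :
    ContinuousOn (fun p : ℝ × E n => g p.1 ‖p.2‖) (s ×ˢ Metric.closedBall 0 R) :=
  (continuousOn_prod_of_continuousOn_lipschitzOnWith (fun p : ℝ × ℝ => g p.1 p.2) D
    (fun v _ => (hg.isProfile v).continuousOn_val)
    (fun r hr => (hg.lipschitz r hr).lipschitzOnWith)).comp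
    (f := fun p : ℝ × E n => (p.1, ‖p.2‖)) (s := s ×ˢ Metric.closedBall 0 R) (t := s ×ˢ Icc 0 R)
    (by fun_prop) fun _ hp => ⟨hp.1, norm_mem_Icc_of_mem_closedBall hp.2⟩

theorem lt_super [NeZero n] {T : ℝ} (hg : IsProfileFamily (fun s => f s + η) q R D g P)
    (hf : Continuous f) (h0 : ∀ s, 0 ≤ f s) (hη : 0 < η) (hq : 0 < q)
    (hT : ∀ v, ∀ r ∈ Icc 0 R, g v r ≤ v + T) {v₀ : ℝ} (hv₀ : ∀ v ≤ v₀, g v R < c) {w : E n → ℝ}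
    (hw : IsBallSuper f R c w) {x : E n} (hx : x ∈ Metric.closedBall 0 R) : g v₀ ‖x‖ < w x := by
  obtain ⟨m, hm⟩ := (isCompact_closedBall (0 : E n) R).bddBelow_image hw.continuousOn
  obtain ⟨a, hav₀, ham⟩ : ∃ a ≤ v₀, a + T < m :=
    ⟨min v₀ (m - T - 1), min_le_left _ _, by linarith [min_le_right v₀ (m - T - 1)]⟩
  refine lt_of_forall_not_touching (isCompact_closedBall (0 : E n) R)
    (F := fun v y => g v ‖y‖) (a := a) ((hg.continuousOn_radial _).sub
      (hw.continuousOn.comp continuousOn_snd fun p hp => hp.2)) (fun y hy => ?_)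
    (fun v hv hle y hy heq => ?_) ⟨hav₀, le_rfl⟩ hx
  · exact (hT a _ (norm_mem_Icc_of_mem_closedBall hy)).trans_lt
      (ham.trans_le (hm (mem_image_of_mem w hy)))
  · rcases (norm_mem_Icc_of_mem_closedBall hy).2.eq_or_lt with hyR | hyR
    · rw [hw.boundary y hyR, hyR] at heq
      exact (hv₀ v hv.2).ne heq
    · exact (hg.isProfile v).ne_of_le_super hf h0 hη (by rwa [hg.init_slope]) hw.super
        (fun y hy => hle y (Metric.ball_subset_closedBall hy)) (mem_ball_zero_iff.mpr hyR) heq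

theorem le_super [NeZero n] {T : ℝ} (hg : IsProfileFamily (fun s => f s + η) q R D g P)
    (hf : Continuous f) (h0 : ∀ s, 0 ≤ f s) (hη : 0 < η) (hq : 0 < q)
    (hT : ∀ v, ∀ r ∈ Icc 0 R, g v r ≤ v + T) {v₀ : ℝ} (hv₀ : ∀ v < v₀, g v R < c) {w : E n → ℝ}
    (hw : IsBallSuper f R c w) {x : E n} (hx : x ∈ Metric.closedBall 0 R) : g v₀ ‖x‖ ≤ w x :=
  le_of_tendsto ((hg.lipschitz _ (norm_mem_Icc_of_mem_closedBall hx)).continuous.continuousWithinAt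
    (s := Iio v₀) (x := v₀)) (eventually_mem_nhdsWithin.mono fun _ hv =>
      (hg.lt_super hf h0 hη hq hT (fun _ hv' => hv₀ _ (hv'.trans_lt hv)) hw hx).le)

end IsProfileFamily

end Comparison

section LeastProfile

variable {n : ℕ} {f g P : ℝ → ℝ} {K : NNReal} {M R : ℝ}

theorem IsProfile.norm_le {Q r : ℝ} (hp : IsProfile f R g P) (h0 : ∀ s, 0 ≤ f s) (hP0 : 0 ≤ P 0)
    (hM : ∀ s, f s ≤ M) (hQ : P 0 + 3 * M * R ≤ Q) (hr : r ∈ Icc 0 R) :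
    ‖(g r, P r)‖ ≤ max (|g R| + Q ^ (1 / 3 : ℝ) * R) Q := by
  have hR : 0 ≤ R := hr.1.trans hr.2
  have hP := hP0.trans (hp.init_slope_le h0 hr)
  have hmono := hp.monotoneOn_val h0 hP0
  have hQ0 := hP.trans (hp.slope_le_of_le h0 hM hr)
  have hval := hp.val_le_add h0 hP0 hM (right_mem_Icc.mpr hR)
  have hcbrt : (P 0 + 3 * M * R) ^ (1 / 3 : ℝ) * R ≤ Q ^ (1 / 3 : ℝ) * R := by gcongr
  refine max_le_max (abs_le.mpr ⟨?_, ?_⟩) ?_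
  · linarith [hmono (left_mem_Icc.mpr hR) hr hr.1, neg_abs_le (g R)]
  · have := mul_nonneg (Real.rpow_nonneg (hQ0.trans hQ) (1 / 3)) hR
    linarith [hmono hr (right_mem_Icc.mpr hR) hr.2, le_abs_self (g R)]
  · rw [Real.norm_of_nonneg hP]
    exact (hp.slope_le_of_le h0 hM hr).trans hQ

theorem exists_strict_profile_le_super [NeZero n] (hK : LipschitzWith K f) (h0 : ∀ s, 0 ≤ f s)
    (hM : ∀ s, f s ≤ M) {q η : ℝ} (hη : 0 < η) (hq : 0 < q) (hR : 0 < R) (c : ℝ) :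
    ∃ g P, IsProfile (fun s => f s + η) R g P ∧ P 0 = q ∧ g R = c ∧
      ∀ w : E n → ℝ, IsBallSuper f R c w → ∀ x ∈ Metric.closedBall 0 R, g ‖x‖ ≤ w x := by
  have h0' : ∀ s, 0 ≤ f s + η := fun s => add_nonneg (h0 s) hη.le
  have hRmem : R ∈ Icc 0 R := right_mem_Icc.mpr hR.le
  obtain ⟨D, g, P, hg⟩ := exists_isProfileFamily (f := fun s => f s + η) (M := M + η)
    (hK.add (LipschitzWith.const η)) h0' (fun s => by linarith [hM s]) hq hR.le
  have hP0 : ∀ v, 0 ≤ P v 0 := fun v => by rw [hg.init_slope]; exact hq.le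
  have hT : ∀ v, ∀ r ∈ Icc 0 R, g v r ≤ v + (q + 3 * (M + η) * R) ^ (1 / 3 : ℝ) * R :=
    fun v r hr => by
      simpa only [hg.init_val, hg.init_slope] using
        (hg.isProfile v).val_le_add h0' (hP0 v) (fun s => by linarith [hM s]) hr
  have hlow : ∀ v, v ≤ g v R := fun v => by
    simpa only [hg.init_val] using
      (hg.isProfile v).monotoneOn_val h0' (hP0 v) (left_mem_Icc.mpr hR.le) hRmem hR.le
  obtain ⟨v, -, hvc, hfirst⟩ :=
    exists_first_eq (hg.lipschitz R hRmem).continuous hlow (fun v => hT v R hRmem) c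
  exact ⟨g v, P v, hg.isProfile v, hg.init_slope v, hvc, fun w hw x hx =>
    hg.le_super hK.continuous h0 hη hq hT hfirst hw hx⟩

theorem exists_least_profile [NeZero n] (hK : LipschitzWith K f) (h0 : ∀ s, 0 ≤ f s)
    (hM : ∀ s, f s ≤ M) (hR : 0 < R) (c : ℝ) :
    ∃ g P, IsProfile f R g P ∧ P 0 = 0 ∧ g R = c ∧
      ∀ w : E n → ℝ, IsBallSuper f R c w → ∀ x ∈ Metric.closedBall 0 R, g ‖x‖ ≤ w x := by
  set η : ℕ → ℝ := fun k => 1 / ((k : ℝ) + 1)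
  have hη0 : ∀ k, 0 < η k := fun k => Nat.one_div_pos_of_nat
  have hη1 : ∀ k, η k ≤ 1 := fun k =>
    (div_le_one (by positivity)).mpr (by linarith [Nat.cast_nonneg (α := ℝ) k])
  have hη : Tendsto η atTop (𝓝 0) := tendsto_one_div_add_atTop_nhds_zero_nat
  choose g P hp hP0 hgR hle using fun k =>
    exists_strict_profile_le_super (n := n) hK h0 hM (hη0 k) (hη0 k) hR c
  have hbound : ∀ k, ∀ t ∈ Icc 0 R, ‖(g k t, P k t)‖ ≤
      max (|c| + (1 + 3 * (M + 1) * R) ^ (1 / 3 : ℝ) * R) (1 + 3 * (M + 1) * R) := fun k t ht => by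
    rw [← hgR k]
    exact (hp k).norm_le (fun s => add_nonneg (h0 s) (hη0 k).le) (hP0 k ▸ (hη0 k).le)
      (fun s => add_le_add (hM s) (hη1 k)) (by rw [hP0]; gcongr; exact hη1 k) ht
  obtain ⟨φ, y, hφ, hy, hlim⟩ := exists_subseq_tendsto_trajectory
    (X := fun z : ℝ × ℝ => (z.2 ^ (1 / 3 : ℝ), 3 * f z.1))
    ((continuous_snd.rpow_const fun _ => Or.inr (by norm_num)).prodMk
      (continuous_const.mul (hK.continuous.comp continuous_fst)))
    (e := fun k => (0, 3 * η k)) (tendsto_const_nhds.prodMk_nhds (by simpa using hη.const_mul 3))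
    (fun k t ht => (((hp k).deriv_val t ht).prodMk ((hp k).deriv_slope t ht)).congr_deriv
      (by simp [mul_add])) hbound
  have hlimg : ∀ t ∈ Icc 0 R, Tendsto (fun k => g (φ k) t) atTop (𝓝 (y t).1) := fun t ht =>
    (continuous_fst.tendsto _).comp (hlim t ht)
  refine ⟨fun t => (y t).1, fun t => (y t).2,
    ⟨fun t ht => (ContinuousLinearMap.fst ℝ ℝ ℝ).hasFDerivAt.comp_hasDerivWithinAt t (hy t ht),
      fun t ht => (ContinuousLinearMap.snd ℝ ℝ ℝ).hasFDerivAt.comp_hasDerivWithinAt t (hy t ht)⟩,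
    ?_, ?_, fun w hw x hx => ?_⟩
  · refine tendsto_nhds_unique
      ((continuous_snd.tendsto _).comp (hlim 0 (left_mem_Icc.mpr hR.le))) ?_
    simpa only [Function.comp_def, hP0] using hη.comp hφ.tendsto_atTop
  · refine tendsto_nhds_unique (hlimg R (right_mem_Icc.mpr hR.le)) ?_
    simp only [hgR, tendsto_const_nhds]
  · exact le_of_tendsto' (hlimg _ (norm_mem_Icc_of_mem_closedBall hx)) fun k => hle _ w hw x hx

end LeastProfile

section FlatProfile

namespace IsProfile

variable {n : ℕ} {f g P : ℝ → ℝ} {R r a : ℝ}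

theorem rhs_eq_zero_of_slope_eq_zero (hp : IsProfile f R g P) (h0 : ∀ s, 0 ≤ f s) (hP0 : P 0 = 0)
    (hr : r ∈ Ioo 0 R) (hP : P r = 0) : f (g r) = 0 := by
  have hmin : IsLocalMin P r := by
    filter_upwards [Ioo_mem_nhds hr.1 hr.2] with s hs
    rw [hP, ← hP0]
    exact hp.init_slope_le h0 (Ioo_subset_Icc_self hs)
  linarith [hmin.hasDerivAt_eq_zero (hp.hasDerivAt_slope hr)]

theorem le_init_of_lt (hp : IsProfile f R g P) (hR : 0 ≤ R) (h0 : ∀ s, 0 ≤ f s) (hP0 : P 0 = 0)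
    (hf : ∀ s ≤ a, f s = 0) (ha : a < g R) : a ≤ g 0 := by
  by_contra! hv
  obtain ⟨r, hr, hgr⟩ : a ∈ g '' Icc 0 R :=
    intermediate_value_Icc hR hp.continuousOn_val ⟨hv.le, ha.le⟩
  have hp' := hp.mono hr.2
  have hmono := hp'.monotoneOn_val h0 hP0.ge
  have hP : ∀ t ∈ Icc 0 r, P t ≤ 0 := fun t ht => by
    have hrhs : ∀ s ∈ Icc 0 r, f (g s) ≤ 0 := fun s hs =>
      (hf _ (hgr ▸ hmono hs (right_mem_Icc.mpr hr.1) hs.2)).le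
    simpa [hP0] using hp'.slope_le_add_mul hrhs ht
  have hle := hp'.val_le_add_mul (fun t ht => hP0.ge.trans (hp'.init_slope_le h0 ht)) hP
    (right_mem_Icc.mpr hr.1)
  norm_num at hle
  linarith

/- Where `f ∘ g > κ` near `0` one has `P r ≥ 3 κ r`, so `g' ≥ (3 κ r)^(1/3)` beats every linear
function. -/
theorem eventually_add_mul_sq_le_val (hp : IsProfile f R g P) (hf : Continuous f) (hR : 0 < R)
    (hP0 : P 0 = 0) (hpos : 0 < f (g 0)) {m : ℝ} (hm : 0 ≤ m) :
    ∀ᶠ r in 𝓝[≥] 0, g 0 + m * r ^ 2 ≤ g r := by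
  obtain ⟨κ, hκ0, hκ⟩ := exists_between hpos
  have hrhs : ∀ᶠ r in 𝓝[≥] 0, κ < f (g r) := by
    have hcont := hf.continuousAt.comp_continuousWithinAt
      (hp.continuousOn_val 0 (left_mem_Icc.mpr hR.le))
    rw [← nhdsWithin_Icc_eq_nhdsGE hR]
    exact hcont.eventually (lt_mem_nhds hκ)
  have hsmall : ∀ᶠ r in 𝓝[≥] (0 : ℝ), (2 * m) ^ 3 * r ^ 2 < 3 * κ :=
    nhdsWithin_le_nhds (ContinuousAt.eventually_lt (by fun_prop) continuousAt_const (by simpa))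
  obtain ⟨d, hd0, hd⟩ := mem_nhdsGE_iff_exists_Icc_subset.mp
    ((hrhs.and hsmall).and (Icc_mem_nhdsGE hR))
  have hp' := hp.mono (hd (right_mem_Icc.mpr (le_of_lt hd0))).2.2
  have hcbrt : ∀ t ∈ Icc 0 d, m * (2 * t) ≤ P t ^ (1 / 3 : ℝ) := fun t ht => by
    have hcube : (m * (2 * t)) ^ 3 ≤ P t := calc
      (m * (2 * t)) ^ 3 = (2 * m) ^ 3 * t ^ 2 * t := by ring
      _ ≤ 3 * κ * t := mul_le_mul_of_nonneg_right (hd ht).1.2.le ht.1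
      _ ≤ P t := by simpa [hP0] using hp'.add_mul_le_slope (fun s hs => (hd hs).1.1.le) ht
    have hbase : 0 ≤ m * (2 * t) := mul_nonneg hm (by linarith [ht.1])
    calc m * (2 * t) = ((m * (2 * t)) ^ 3) ^ (1 / 3 : ℝ) := by
          rw [← Real.rpow_natCast, ← Real.rpow_mul hbase]
          norm_num
      _ ≤ P t ^ (1 / 3 : ℝ) := Real.rpow_le_rpow (by positivity) hcube (by norm_num)
  filter_upwards [Icc_mem_nhdsGE hd0] with r hr
  have hle := sub_le_sub_of_hasDerivWithinAt_le
    (fun t _ => ((hasDerivAt_pow 2 t).const_mul m).hasDerivWithinAt) hp'.deriv_val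
    (fun t ht => by simpa using hcbrt t ht) (left_mem_Icc.mpr (le_of_lt hd0)) hr hr.1
  norm_num at hle
  linarith

theorem not_isLocalMax_radial_sub [NeZero n] (hp : IsProfile f R g P) (hf : Continuous f)
    (hR : 0 < R) (hP0 : P 0 = 0) (hpos : 0 < f (g 0)) {φ : E n → ℝ} (hφ : ContDiffAt ℝ 2 φ 0) :
    ¬ IsLocalMax (fun y => g ‖y‖ - φ y) 0 := by
  intro hmax
  obtain ⟨e, he⟩ := exists_norm_eq (E n) zero_le_one
  set A := fderiv ℝ (fderiv ℝ φ) 0 e e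
  have habs : Tendsto (fun t : ℝ => |t|) (𝓝 0) (𝓝[≥] 0) := tendsto_nhdsWithin_iff.mpr
    ⟨Continuous.tendsto' (by fun_prop) _ _ abs_zero, .of_forall fun t => abs_nonneg t⟩
  have hmin : IsLocalMin (fun t : ℝ => φ (0 + t • e) - (|A| + 1) * t ^ 2) 0 := by
    filter_upwards [(tendsto_line 0 e).eventually hmax, habs.eventually
      (hp.eventually_add_mul_sq_le_val hf hR hP0 hpos (m := |A| + 1) (by positivity))]
      with t htouch hgrow
    have hnorm : ‖(0 : E n) + t • e‖ = |t| := by simp [norm_smul, he]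
    simp only [hnorm, norm_zero, sq_abs] at htouch hgrow
    simp only [zero_smul, add_zero]
    linarith
  have hderiv2 : 0 ≤ A - (|A| + 1) * 2 := by
    refine second_deriv_nonneg_of_isLocalMin (ψ' := fun t =>
      fderiv ℝ φ (0 + t • e) e - (|A| + 1) * (2 * t)) ?_ ?_ hmin
    · filter_upwards [eventually_hasDerivAt_comp_line hφ e] with t ht
      exact (ht.sub ((hasDerivAt_pow 2 t).const_mul (|A| + 1))).congr_deriv (by simp)
    · exact ((hasDerivAt_fderiv_comp_line hφ e).sub
        (((hasDerivAt_id (0 : ℝ)).const_mul 2).const_mul (|A| + 1))).congr_deriv (by simp [A])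
  linarith [le_abs_self A, abs_nonneg A]

theorem hasFDerivAt_radial_of_slope_eq_zero (hp : IsProfile f R g P) {x : E n} (hx : ‖x‖ < R)
    (hP : P ‖x‖ = 0) : HasFDerivAt (fun y : E n => g ‖y‖) (0 : E n →L[ℝ] ℝ) x := by
  have hR : 0 < R := (norm_nonneg x).trans_lt hx
  have hcbrt : P ‖x‖ ^ (1 / 3 : ℝ) = 0 := by rw [hP, Real.zero_rpow (by norm_num)]
  rcases eq_or_ne x 0 with rfl | hne
  · rw [norm_zero] at hcbrt
    have hderiv := hp.deriv_val 0 (left_mem_Icc.mpr hR.le)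
    rw [hcbrt] at hderiv
    exact hasFDerivAt_radial_zero hR hderiv
  · have := hasFDerivAt_radial hne (hp.hasDerivAt_val ⟨norm_pos_iff.mpr hne, hx⟩)
    rwa [hcbrt, zero_smul] at this

theorem continuousOn_radial (hp : IsProfile f R g P) :
    ContinuousOn (fun x : E n => g ‖x‖) (Metric.closedBall 0 R) :=
  hp.continuousOn_val.comp continuous_norm.continuousOn fun _ => norm_mem_Icc_of_mem_closedBall

theorem isViscositySol [NeZero n] (hp : IsProfile f R g P) (hf : Continuous f)
    (h0 : ∀ s, 0 ≤ f s) (hP0 : P 0 = 0) :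
    IsViscositySol f (Metric.ball (0 : E n) R) (fun x => g ‖x‖) := by
  have hcont : ContinuousOn (fun x : E n => g ‖x‖) (Metric.ball 0 R) :=
    hp.continuousOn_radial.mono Metric.ball_subset_closedBall
  have hsmooth : ∀ x : E n, ‖x‖ < R → 0 < P ‖x‖ → ContDiffAt ℝ 2 (fun y : E n => g ‖y‖) x ∧
      infLaplacian (fun y : E n => g ‖y‖) x = f (g ‖x‖) := fun x hx hP => by
    have hne : x ≠ 0 := fun h => by simp [h, hP0] at hP
    exact ⟨contDiffAt_radial hne (hp.contDiffAt_val hf ⟨norm_pos_iff.mpr hne, hx⟩ hP),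
      hp.infLaplacian_eq hf hne hx hP⟩
  refine ⟨⟨hcont, fun x hx φ hφ hmax => ?_⟩, hcont, fun x hx φ hφ hmin => ?_⟩ <;>
    rw [mem_ball_zero_iff] at hx <;>
    rcases (hP0.ge.trans (hp.init_slope_le h0 ⟨norm_nonneg x, hx.le⟩)).eq_or_lt with hP | hP
  · rw [infLaplacian_eq_zero_of_isLocalExtr_sub (hp.hasFDerivAt_radial_of_slope_eq_zero hx hP.symm)
      (hφ.differentiableAt (by norm_num)) (Or.inr hmax)]
    rcases eq_or_ne x 0 with rfl | hne
    · by_contra! hpos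
      rw [norm_zero] at hx hpos
      exact hp.not_isLocalMax_radial_sub hf hx hP0 hpos hφ hmax
    · exact (hp.rhs_eq_zero_of_slope_eq_zero h0 hP0 ⟨norm_pos_iff.mpr hne, hx⟩ hP.symm).le
  · exact (hsmooth x hx hP).2 ▸ infLaplacian_le_of_isLocalMax_sub (hsmooth x hx hP).1 hφ hmax
  · rw [infLaplacian_eq_zero_of_isLocalExtr_sub (hp.hasFDerivAt_radial_of_slope_eq_zero hx hP.symm)
      (hφ.differentiableAt (by norm_num)) (Or.inl hmin)]
    exact h0 _
  · exact (hsmooth x hx hP).2 ▸ infLaplacian_le_of_isLocalMin_sub (hsmooth x hx hP).1 hφ hmin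

end IsProfile

end FlatProfile

section Constants

variable {γ r : ℝ}

theorem alpha_pos (hγ : -3 < γ) : 0 < alpha γ := div_pos four_pos (by linarith)

theorem one_lt_alpha (hγ : -3 < γ) (hγ1 : γ < 1) : 1 < alpha γ :=
  (one_lt_div (by linarith)).mpr (by linarith)

theorem alpha_mul (hγ : -3 < γ) : alpha γ * (3 + γ) = 4 := div_mul_cancel₀ 4 (by linarith)

theorem radialConst_pos (hγ : -3 < γ) (hγ1 : γ < 1) : 0 < radialConst γ := by
  have hα := alpha_pos hγ
  have hα1 := sub_pos.mpr (one_lt_alpha hγ hγ1)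
  rw [radialConst]
  positivity

theorem radialConst_rpow (hγ : -3 < γ) (hγ1 : γ < 1) :
    radialConst γ ^ (-γ) = radialConst γ ^ 3 * alpha γ ^ 3 * (alpha γ - 1) := by
  have hα := alpha_pos hγ
  have hα1 := sub_pos.mpr (one_lt_alpha hγ hγ1)
  have hpow : radialConst γ ^ (3 + γ) = 1 / (alpha γ ^ 3 * (alpha γ - 1)) := by
    rw [radialConst, ← Real.rpow_mul (by positivity), one_div_mul_cancel (by linarith),
      Real.rpow_one]
  have hsplit : radialConst γ ^ 3 = radialConst γ ^ (3 + γ) * radialConst γ ^ (-γ) := by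
    rw [← Real.rpow_add (radialConst_pos hγ hγ1), ← Real.rpow_natCast]
    norm_num
  rw [hsplit, hpow]
  field_simp

theorem sq_deriv_mul_second_deriv_radialConst_mul_rpow (hγ : -3 < γ) (hγ1 : γ < 1) (hr : 0 < r) :
    (radialConst γ * (alpha γ * r ^ (alpha γ - 1))) ^ 2 *
      (radialConst γ * (alpha γ * ((alpha γ - 1) * r ^ (alpha γ - 1 - 1)))) =
      (radialConst γ * r ^ alpha γ) ^ (-γ) := by
  have hpow : r ^ (alpha γ * -γ) = (r ^ (alpha γ - 1)) ^ 2 * r ^ (alpha γ - 1 - 1) := by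
    rw [← Real.rpow_natCast, ← Real.rpow_mul hr.le, ← Real.rpow_add hr]
    congr 1
    push_cast
    linarith [alpha_mul hγ]
  rw [Real.mul_rpow (radialConst_pos hγ hγ1).le (by positivity), ← Real.rpow_mul hr.le, hpow,
    radialConst_rpow hγ hγ1]
  ring

theorem deriv_radialConst_mul_rpow_pow_four (hγ : -3 < γ) (hγ1 : γ < 1) (hr : 0 < r) :
    (radialConst γ * (alpha γ * r ^ (alpha γ - 1))) ^ 4 =
      4 / (1 - γ) * (radialConst γ * r ^ alpha γ) ^ (1 - γ) := by
  have hC := radialConst_pos hγ hγ1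
  have hγα : 4 / (1 - γ) * (alpha γ - 1) = alpha γ := by
    rw [div_mul_eq_mul_div, div_eq_iff (by linarith)]
    linarith [alpha_mul hγ]
  have hpow : r ^ (alpha γ - 1) * r ^ (alpha γ - 1) = r ^ alpha γ * r ^ (alpha γ - 1 - 1) := by
    rw [← Real.rpow_add hr, ← Real.rpow_add hr]
    congr 1
    ring
  rw [sub_eq_add_neg 1 γ, Real.rpow_add (by positivity), Real.rpow_one,
    ← sq_deriv_mul_second_deriv_radialConst_mul_rpow hγ hγ1 hr, ← sub_eq_add_neg]
  generalize r ^ (alpha γ - 1) = q, r ^ (alpha γ - 1 - 1) = w, r ^ alpha γ = z at hpow ⊢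
  linear_combination radialConst γ ^ 4 * alpha γ ^ 4 * q ^ 2 * hpow -
    radialConst γ ^ 4 * alpha γ ^ 3 * q ^ 2 * z * w * hγα

end Constants

/-- The inverse of the radial profile `r ↦ C_α r ^ α` on `[0, ∞)`. -/
noncomputable def radius (γ s : ℝ) : ℝ := (s / radialConst γ) ^ (1 / alpha γ)

section Radius

variable {γ s : ℝ}

theorem radialConst_mul_radius_rpow (hγ : -3 < γ) (hγ1 : γ < 1) (hs : 0 ≤ s) :
    radialConst γ * radius γ s ^ alpha γ = s := by
  have hC := radialConst_pos hγ hγ1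
  rw [radius, ← Real.rpow_mul (by positivity), one_div_mul_cancel (alpha_pos hγ).ne',
    Real.rpow_one, mul_div_cancel₀ s hC.ne']

theorem radius_radialConst_mul_rpow (hγ : -3 < γ) (hγ1 : γ < 1) {r : ℝ} (hr : 0 ≤ r) :
    radius γ (radialConst γ * r ^ alpha γ) = r := by
  rw [radius, mul_div_cancel_left₀ _ (radialConst_pos hγ hγ1).ne', ← Real.rpow_mul hr,
    mul_one_div_cancel (alpha_pos hγ).ne', Real.rpow_one]

theorem radius_pos (hγ : -3 < γ) (hγ1 : γ < 1) (hs : 0 < s) : 0 < radius γ s :=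
  Real.rpow_pos_of_pos (div_pos hs (radialConst_pos hγ hγ1)) _

theorem continuous_radius (hγ : -3 < γ) : Continuous (radius γ) :=
  (continuous_id.div_const _).rpow_const fun _ => Or.inr (one_div_pos.mpr (alpha_pos hγ)).le

theorem hasDerivAt_radialConst_mul_rpow {r : ℝ} (hr : 0 < r) :
    HasDerivAt (fun t => radialConst γ * t ^ alpha γ)
      (radialConst γ * (alpha γ * r ^ (alpha γ - 1))) r :=
  (Real.hasDerivAt_rpow_const (Or.inl hr.ne')).const_mul _

theorem hasDerivAt_radius (hγ : -3 < γ) (hγ1 : γ < 1) (hs : 0 < s) :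
    HasDerivAt (radius γ) (radialConst γ * (alpha γ * radius γ s ^ (alpha γ - 1)))⁻¹ s := by
  have hC := radialConst_pos hγ hγ1
  have hα := alpha_pos hγ
  have hr := radius_pos hγ hγ1 hs
  refine HasDerivAt.of_local_left_inverse (continuous_radius hγ).continuousAt
    (hasDerivAt_radialConst_mul_rpow hr) (by positivity) ?_
  filter_upwards [lt_mem_nhds hs] with t ht using radialConst_mul_radius_rpow hγ hγ1 ht.le

end Radius

section Penalization

variable {γ δ ε s : ℝ} {B : ℝ → ℝ}

theorem IsCutoff.apply_mem_Icc (hB : IsCutoff δ B) (s : ℝ) : B s ∈ Icc (0 : ℝ) 1 := by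
  rcases le_total 0 s with hs | hs
  · exact hB.mem_Icc s hs
  · simp [hB.eq_zero s (by linarith [hB.delta_pos])]

theorem penalizedRHS_eq_zero (hB : IsCutoff δ B) (hε : 0 < ε) (hs : s ≤ δ / 2 * ε ^ alpha γ) :
    penalizedRHS γ B ε s = 0 := by
  rw [penalizedRHS, hB.eq_zero _ ((div_le_iff₀ (by positivity)).mpr hs), zero_mul]

theorem penalizedRHS_eq_rpow (hB : IsCutoff δ B) (hε : 0 < ε) (hs : δ * ε ^ alpha γ ≤ s) :
    penalizedRHS γ B ε s = s ^ (-γ) := by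
  rw [penalizedRHS, hB.eq_one _ ((le_div_iff₀ (by positivity)).mpr hs), one_mul]

theorem penalizedRHS_le_rpow (hB : IsCutoff δ B) (hs : 0 ≤ s) :
    penalizedRHS γ B ε s ≤ s ^ (-γ) :=
  mul_le_of_le_one_left (Real.rpow_nonneg hs _) (hB.apply_mem_Icc _).2

theorem penalizedRHS_eq_mul_max_rpow (hB : IsCutoff δ B) (hε : 0 < ε) (s : ℝ) :
    penalizedRHS γ B ε s = B (s / ε ^ alpha γ) * max s (δ / 2 * ε ^ alpha γ) ^ (-γ) := by
  rcases le_total s (δ / 2 * ε ^ alpha γ) with hs | hs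
  · rw [penalizedRHS_eq_zero hB hε hs, hB.eq_zero _ ((div_le_iff₀ (by positivity)).mpr hs),
      zero_mul]
  · rw [max_eq_left hs, penalizedRHS]

theorem penalizedRHS_nonneg (hB : IsCutoff δ B) (hε : 0 < ε) (s : ℝ) :
    0 ≤ penalizedRHS γ B ε s := by
  have := hB.delta_pos
  rw [penalizedRHS_eq_mul_max_rpow hB hε]
  exact mul_nonneg (hB.apply_mem_Icc _).1 (by positivity)

theorem max_rpow_neg_mem_Icc (hγ : 0 ≤ γ) {a : ℝ} (ha : 0 < a) (s : ℝ) :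
    max s a ^ (-γ) ∈ Icc 0 (a ^ (-γ)) :=
  ⟨by positivity, Real.rpow_le_rpow_of_nonpos ha (le_max_right _ _) (neg_nonpos.mpr hγ)⟩

theorem penalizedRHS_le (hγ : 0 ≤ γ) (hB : IsCutoff δ B) (hε : 0 < ε) (s : ℝ) :
    penalizedRHS γ B ε s ≤ (δ / 2 * ε ^ alpha γ) ^ (-γ) := by
  have := hB.delta_pos
  have hmax := max_rpow_neg_mem_Icc hγ (a := δ / 2 * ε ^ alpha γ) (by positivity) s
  rw [penalizedRHS_eq_mul_max_rpow hB hε]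
  exact (mul_le_of_le_one_left hmax.1 (hB.apply_mem_Icc _).2).trans hmax.2

theorem exists_lipschitzWith_penalizedRHS (hγ : 0 ≤ γ) (hB : IsCutoff δ B) (hε : 0 < ε) :
    ∃ K, LipschitzWith K (penalizedRHS γ B ε) := by
  obtain ⟨K, hK⟩ := hB.lipschitz
  have := hB.delta_pos
  set a := δ / 2 * ε ^ alpha γ
  have ha : 0 < a := by positivity
  have hcut := hK.comp (lipschitzWith_smul (ε ^ alpha γ)⁻¹)
  have hpow := lipschitzOnWith_univ.mp ((lipschitzOnWith_rpow_const_Ici ha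
    (show -γ ≤ 1 by linarith)).comp (LipschitzWith.id.max_const a).lipschitzOnWith
    fun s _ => le_max_right s a)
  have hmul := lipschitzWith_mul_of_abs_le (M := 1) (N := (a ^ (-γ)).toNNReal) hcut hpow
    (fun s => (abs_of_nonneg (hB.apply_mem_Icc _).1).trans_le (hB.apply_mem_Icc _).2)
    (fun s => by
      have hmem := max_rpow_neg_mem_Icc hγ ha s
      rw [Real.coe_toNNReal _ (hmem.1.trans hmem.2)]
      exact (abs_of_nonneg hmem.1).trans_le hmem.2)
  have hproduct : penalizedRHS γ B ε = fun s => B ((ε ^ alpha γ)⁻¹ • s) * max s a ^ (-γ) :=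
    funext fun s => by rw [penalizedRHS_eq_mul_max_rpow hB hε, div_eq_inv_mul, smul_eq_mul]
  exact ⟨_, hproduct ▸ hmul⟩

end Penalization

section Energy

namespace IsProfile

variable {γ R r : ℝ} {f g P : ℝ → ℝ}

theorem slope_rpow_le (hp : IsProfile f R g P) (hγ1 : γ < 1) (h0 : ∀ s, 0 ≤ f s)
    (hfγ : ∀ s, 0 < s → f s ≤ s ^ (-γ)) (hP0 : P 0 = 0) (hg0 : 0 < g 0) (hr : r ∈ Icc 0 R) :
    P r ^ (4 / 3 : ℝ) ≤ 4 / (1 - γ) * g r ^ (1 - γ) := by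
  have h0mem : (0 : ℝ) ∈ Icc 0 R := left_mem_Icc.mpr (hr.1.trans hr.2)
  have hg : ∀ t ∈ Icc 0 R, 0 < g t := fun t ht =>
    hg0.trans_le (hp.monotoneOn_val h0 hP0.ge h0mem ht ht.1)
  have hγ : 0 < 1 - γ := sub_pos.mpr hγ1
  have hle := sub_le_sub_of_hasDerivWithinAt_le (f' := fun t => 4 * P t ^ (1 / 3 : ℝ) * f (g t))
    (g' := fun t => 4 * P t ^ (1 / 3 : ℝ) * g t ^ (-γ))
    (fun t ht => ((hp.deriv_slope t ht).rpow_const (p := 4 / 3)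
      (Or.inr (by norm_num))).congr_deriv (by norm_num; ring))
    (fun t ht => (((hp.deriv_val t ht).rpow_const (p := 1 - γ)
      (Or.inl (hg t ht).ne')).const_mul (4 / (1 - γ))).congr_deriv
        (by rw [sub_sub_cancel_left]; field_simp))
    (fun t ht => by
      have hP : 0 ≤ P t := hP0.ge.trans (hp.init_slope_le h0 ht)
      have := hfγ _ (hg t ht)
      gcongr) h0mem hr hr.1
  rw [hP0, Real.zero_rpow (by norm_num)] at hle
  have : 0 ≤ 4 / (1 - γ) * g 0 ^ (1 - γ) := by positivity
  linarith

theorem cbrt_slope_le (hp : IsProfile f R g P) (hγ : -3 < γ) (hγ1 : γ < 1) (h0 : ∀ s, 0 ≤ f s)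
    (hfγ : ∀ s, 0 < s → f s ≤ s ^ (-γ)) (hP0 : P 0 = 0) (hg0 : 0 < g 0) (hr : r ∈ Icc 0 R) :
    P r ^ (1 / 3 : ℝ) ≤ radialConst γ * (alpha γ * radius γ (g r) ^ (alpha γ - 1)) := by
  have hC := radialConst_pos hγ hγ1
  have hα := alpha_pos hγ
  have hg : 0 < g r := hg0.trans_le
    (hp.monotoneOn_val h0 hP0.ge (left_mem_Icc.mpr (hr.1.trans hr.2)) hr hr.1)
  have hz := radius_pos hγ hγ1 hg
  have hP : 0 ≤ P r := hP0.ge.trans (hp.init_slope_le h0 hr)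
  refine le_of_pow_le_pow_left₀ four_ne_zero (by positivity) ?_
  calc (P r ^ (1 / 3 : ℝ)) ^ 4 = P r ^ (4 / 3 : ℝ) := by
        rw [← Real.rpow_natCast, ← Real.rpow_mul hP]
        norm_num
    _ ≤ 4 / (1 - γ) * g r ^ (1 - γ) := hp.slope_rpow_le hγ1 h0 hfγ hP0 hg0 hr
    _ = _ := by
        rw [deriv_radialConst_mul_rpow_pow_four hγ hγ1 hz,
          radialConst_mul_radius_rpow hγ hγ1 hg.le]

theorem radius_sub_radius_le (hp : IsProfile f R g P) (hγ : -3 < γ) (hγ1 : γ < 1)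
    (h0 : ∀ s, 0 ≤ f s) (hfγ : ∀ s, 0 < s → f s ≤ s ^ (-γ)) (hP0 : P 0 = 0) (hg0 : 0 < g 0)
    (hr : r ∈ Icc 0 R) : radius γ (g R) - radius γ (g r) ≤ R - r := by
  have hC := radialConst_pos hγ hγ1
  have hα := alpha_pos hγ
  have hR : 0 ≤ R := hr.1.trans hr.2
  have hg : ∀ t ∈ Icc 0 R, 0 < g t := fun t ht =>
    hg0.trans_le (hp.monotoneOn_val h0 hP0.ge (left_mem_Icc.mpr hR) ht ht.1)
  refine sub_le_sub_of_hasDerivWithinAt_le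
    (fun t ht => (hasDerivAt_radius hγ hγ1 (hg t ht)).comp_hasDerivWithinAt t (hp.deriv_val t ht))
    (fun t _ => hasDerivWithinAt_id t _) (fun t ht => ?_) hr (right_mem_Icc.mpr hR) hr.2
  have hz := radius_pos hγ hγ1 (hg t ht)
  exact inv_mul_le_one_of_le₀ (hp.cbrt_slope_le hγ hγ1 h0 hfγ hP0 hg0 ht) (by positivity)

end IsProfile

end Energy

section ShiftedProfile

variable {n : ℕ} {γ h p r ε R : ℝ}

theorem hasDerivAt_add_const_rpow (hr : 0 < r + h) :
    HasDerivAt (fun t => (t + h) ^ p) (p * (r + h) ^ (p - 1)) r := by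
  simpa using ((hasDerivAt_id r).add_const h).rpow_const (p := p) (Or.inl hr.ne')

theorem contDiffAt_add_const_rpow (hr : 0 < r + h) : ContDiffAt ℝ 2 (fun t => (t + h) ^ p) r :=
  (contDiffAt_id.add contDiffAt_const).rpow_const_of_ne hr.ne'

theorem eventually_add_pos (hr : 0 < r + h) : ∀ᶠ t in 𝓝 r, 0 < t + h := by
  filter_upwards [lt_mem_nhds (show -h < r by linarith)] with t ht using by linarith

theorem omegaShift_zero_left : (omegaShift γ 0 : E n → ℝ) = omega γ :=
  funext fun x => by rw [omegaShift, omega, add_zero]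

theorem eqOn_omegaShift_frontier_ball (hR : R ≠ 0) :
    EqOn (omegaShift γ ε) (fun _ => radialConst γ * (R + ε) ^ alpha γ)
      (frontier (Metric.ball (0 : E n) R)) := by
  intro x hx
  rw [frontier_ball _ hR, mem_sphere_zero_iff_norm] at hx
  rw [omegaShift, hx]

theorem eqOn_omega_frontier_ball (hR : R ≠ 0) :
    EqOn (omega γ) (fun _ => radialConst γ * R ^ alpha γ) (frontier (Metric.ball (0 : E n) R)) := by
  simpa [omegaShift_zero_left] using eqOn_omegaShift_frontier_ball (n := n) (γ := γ) (ε := 0) hR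

theorem contDiffAt_omegaShift {x : E n} (hε : 0 ≤ ε) (hx : x ≠ 0) :
    ContDiffAt ℝ 2 (omegaShift γ ε) x :=
  contDiffAt_radial hx (contDiffAt_const.mul
    (contDiffAt_add_const_rpow (add_pos_of_pos_of_nonneg (norm_pos_iff.mpr hx) hε)))

theorem infLaplacian_omegaShift (hγ : -3 < γ) (hγ1 : γ < 1) {x : E n} (hε : 0 ≤ ε) (hx : x ≠ 0) :
    infLaplacian (omegaShift γ ε) x = omegaShift γ ε x ^ (-γ) := by
  have hr : 0 < ‖x‖ + ε := add_pos_of_pos_of_nonneg (norm_pos_iff.mpr hx) hε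
  refine (infLaplacian_radial hx (contDiffAt_const.mul (contDiffAt_add_const_rpow hr))
    ((eventually_add_pos hr).mono fun t ht => (hasDerivAt_add_const_rpow ht).const_mul _)
    (((hasDerivAt_add_const_rpow hr).const_mul _).const_mul _)).trans ?_
  exact sq_deriv_mul_second_deriv_radialConst_mul_rpow hγ hγ1 hr

theorem isViscositySol_omegaShift (hγ : -3 < γ) (hγ1 : γ < 1) (hε : 0 ≤ ε) {G : ℝ → ℝ}
    {Ω : Set (E n)} (hΩ : ∀ x ∈ Ω, x ≠ 0)
    (hG : ∀ x ∈ Ω, G (omegaShift γ ε x) = omegaShift γ ε x ^ (-γ)) :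
    IsViscositySol G Ω (omegaShift γ ε) :=
  isViscositySol_of_contDiffAt (fun x hx => contDiffAt_omegaShift hε (hΩ x hx)) fun x hx => by
    rw [infLaplacian_omegaShift hγ hγ1 hε (hΩ x hx), hG x hx]

end ShiftedProfile

/-- The shifted profile `C_α (r + h) ^ α` minus its linear part at `0`. For `C_α h ^ α = δ ε ^ α`
the function `flatProfile γ h ‖x‖` is a supersolution of the penalized equation, also at the
origin, where its gradient vanishes. -/
noncomputable def flatProfile (γ h r : ℝ) : ℝ :=
  radialConst γ * ((r + h) ^ alpha γ - alpha γ * h ^ (alpha γ - 1) * r)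

section FlatProfile

variable {n : ℕ} {γ h r R : ℝ} {G : ℝ → ℝ}

theorem hasDerivAt_flatProfile (hr : 0 < r + h) : HasDerivAt (flatProfile γ h)
    (radialConst γ * (alpha γ * (r + h) ^ (alpha γ - 1) - alpha γ * h ^ (alpha γ - 1))) r :=
  (((hasDerivAt_add_const_rpow hr).sub
    ((hasDerivAt_id r).const_mul _)).const_mul (radialConst γ)).congr_deriv (by simp)

theorem contDiffAt_flatProfile (hr : 0 < r + h) : ContDiffAt ℝ 2 (flatProfile γ h) r :=
  contDiffAt_const.mul ((contDiffAt_add_const_rpow hr).sub (contDiffAt_const.mul contDiffAt_id))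

theorem flatProfile_zero : flatProfile γ h 0 = radialConst γ * h ^ alpha γ := by
  simp [flatProfile]

theorem flatProfile_le (hγ : -3 < γ) (hγ1 : γ < 1) (hh : 0 ≤ h) (hr : 0 ≤ r) :
    flatProfile γ h r ≤ radialConst γ * (r + h) ^ alpha γ := by
  have hC := radialConst_pos hγ hγ1
  have hα := alpha_pos hγ
  exact mul_le_mul_of_nonneg_left (sub_le_self _ (by positivity)) hC.le

theorem deriv_flatProfile_nonneg (hγ : -3 < γ) (hγ1 : γ < 1) (hh : 0 ≤ h) (hr : 0 ≤ r) :
    0 ≤ radialConst γ * (alpha γ * (r + h) ^ (alpha γ - 1) - alpha γ * h ^ (alpha γ - 1)) := by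
  have hα := alpha_pos hγ
  have hα1 := sub_pos.mpr (one_lt_alpha hγ hγ1)
  refine mul_nonneg (radialConst_pos hγ hγ1).le (sub_nonneg.mpr ?_)
  gcongr
  linarith

theorem le_flatProfile (hγ : -3 < γ) (hγ1 : γ < 1) (hh : 0 < h) (hr : 0 ≤ r) :
    radialConst γ * h ^ alpha γ ≤ flatProfile γ h r := by
  have hle := sub_le_sub_of_hasDerivWithinAt_le (f := fun _ => 0)
    (fun t _ => hasDerivWithinAt_const t _ 0)
    (fun t ht => HasDerivAt.hasDerivWithinAt
      (hasDerivAt_flatProfile (γ := γ) (add_pos_of_nonneg_of_pos ht.1 hh)))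
    (fun t ht => deriv_flatProfile_nonneg hγ hγ1 hh.le ht.1) (left_mem_Icc.mpr hr)
    (right_mem_Icc.mpr hr) hr
  rw [flatProfile_zero] at hle
  linarith

theorem infLaplacian_flatProfile_le (hγ : 0 ≤ γ) (hγ1 : γ < 1) (hh : 0 < h) {x : E n}
    (hx : x ≠ 0) : infLaplacian (fun y => flatProfile γ h ‖y‖) x ≤ flatProfile γ h ‖x‖ ^ (-γ) := by
  have hγ3 : -3 < γ := by linarith
  have hC := radialConst_pos hγ3 hγ1
  have hα := alpha_pos hγ3
  have hα1 := sub_pos.mpr (one_lt_alpha hγ3 hγ1)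
  have hr : 0 < ‖x‖ + h := by positivity
  have hslope := deriv_flatProfile_nonneg hγ3 hγ1 hh.le (norm_nonneg x)
  have hpos : 0 < flatProfile γ h ‖x‖ :=
    lt_of_lt_of_le (by positivity) (le_flatProfile hγ3 hγ1 hh (norm_nonneg x))
  calc infLaplacian (fun y => flatProfile γ h ‖y‖) x
      = _ := infLaplacian_radial hx (contDiffAt_flatProfile hr)
        ((eventually_add_pos hr).mono fun t ht => hasDerivAt_flatProfile ht)
        ((((hasDerivAt_add_const_rpow hr).const_mul _).sub_const _).const_mul _)
    _ ≤ (radialConst γ * (alpha γ * (‖x‖ + h) ^ (alpha γ - 1))) ^ 2 *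
        (radialConst γ * (alpha γ * ((alpha γ - 1) * (‖x‖ + h) ^ (alpha γ - 1 - 1)))) := by
        gcongr
        exact sub_le_self _ (by positivity)
    _ = (radialConst γ * (‖x‖ + h) ^ alpha γ) ^ (-γ) :=
        sq_deriv_mul_second_deriv_radialConst_mul_rpow hγ3 hγ1 hr
    _ ≤ flatProfile γ h ‖x‖ ^ (-γ) := Real.rpow_le_rpow_of_nonpos hpos
        (flatProfile_le hγ3 hγ1 hh.le (norm_nonneg x)) (neg_nonpos.mpr hγ)

theorem isBallSuper_flatProfile (hγ : 0 ≤ γ) (hγ1 : γ < 1) (hh : 0 < h) (hR : 0 < R)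
    (hG : ∀ s, radialConst γ * h ^ alpha γ ≤ s → s ^ (-γ) ≤ G s) :
    IsBallSuper G R (flatProfile γ h R) (fun x : E n => flatProfile γ h ‖x‖) := by
  have hγ3 : -3 < γ := by linarith
  have hcont : Continuous fun x : E n => flatProfile γ h ‖x‖ :=
    continuous_iff_continuousAt.mpr fun x =>
      (contDiffAt_flatProfile (by positivity)).continuousAt.comp continuous_norm.continuousAt
  have hle : ∀ x : E n, flatProfile γ h ‖x‖ ^ (-γ) ≤ G (flatProfile γ h ‖x‖) := fun x =>
    hG _ (le_flatProfile hγ3 hγ1 hh (norm_nonneg x))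
  refine ⟨hcont.continuousOn, fun x hx => by rw [hx], hcont.continuousOn, fun x _ φ hφ hmin => ?_⟩
  rcases eq_or_ne x 0 with rfl | hx
  · have hgrad : HasFDerivAt (fun x : E n => flatProfile γ h ‖x‖) 0 0 :=
      hasFDerivAt_radial_zero hR
        ((hasDerivAt_flatProfile (by simpa)).congr_deriv (by simp)).hasDerivWithinAt
    rw [infLaplacian_eq_zero_of_isLocalExtr_sub hgrad (hφ.differentiableAt (by norm_num))
      (Or.inl hmin)]
    have hC := radialConst_pos hγ3 hγ1
    exact (Real.rpow_nonneg (by rw [norm_zero, flatProfile_zero]; positivity) _).trans (hle 0)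
  · exact (infLaplacian_le_of_isLocalMin_sub
      (contDiffAt_radial hx (contDiffAt_flatProfile (by positivity))) hφ hmin).trans
        ((infLaplacian_flatProfile_le hγ hγ1 hh hx).trans (hle x))

end FlatProfile

section UniformConvergence

variable {ι X : Type*} {l : Filter ι} {s : Set X}

theorem tendstoUniformlyOn_of_tendsto_param {A Y : Type*} [TopologicalSpace A]
    [TopologicalSpace X] [UniformSpace Y] {F : A → X → Y} (hF : Continuous F.uncurry)
    (hs : IsCompact s) {e : ι → A} {a : A} (he : Tendsto e l (𝓝 a)) :
    TendstoUniformlyOn (fun i => F (e i)) (F a) l s := by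
  intro V hV
  obtain ⟨v, hv, hclose⟩ := hs.mem_uniformity_of_prod (s := univ) hF.continuousOn (mem_univ a)
    (symm_le_uniformity hV)
  rw [nhdsWithin_univ] at hv
  exact (he.eventually hv).mono fun i hi => hclose (e i) hi

theorem tendstoUniformlyOn_of_le_of_le {F G H : ι → X → ℝ} {u : X → ℝ}
    (hF : TendstoUniformlyOn F u l s) (hH : TendstoUniformlyOn H u l s)
    (hFG : ∀ᶠ i in l, ∀ x ∈ s, F i x ≤ G i x) (hGH : ∀ᶠ i in l, ∀ x ∈ s, G i x ≤ H i x) :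
    TendstoUniformlyOn G u l s := by
  rw [Metric.tendstoUniformlyOn_iff] at *
  intro η hη
  filter_upwards [hF η hη, hH η hη, hFG, hGH] with i hFi hHi hFGi hGHi x hx
  have hlow := abs_lt.mp (hFi x hx)
  have hupp := abs_lt.mp (hHi x hx)
  exact abs_lt.mpr ⟨by linarith [hGHi x hx], by linarith [hFGi x hx]⟩

end UniformConvergence

/-- The profile `C_α t ^ α` of `ω`, extended continuously by `0` to `t < 0`. -/
noncomputable def powerProfile (γ t : ℝ) : ℝ := radialConst γ * max t 0 ^ alpha γ

section PowerProfile

variable {n : ℕ} {γ R t : ℝ}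

theorem powerProfile_of_nonneg (ht : 0 ≤ t) : powerProfile γ t = radialConst γ * t ^ alpha γ := by
  rw [powerProfile, max_eq_left ht]

theorem continuous_powerProfile (hγ : -3 < γ) : Continuous (powerProfile γ) :=
  continuous_const.mul ((continuous_id.max continuous_const).rpow_const
    fun _ => Or.inr (alpha_pos hγ).le)

theorem powerProfile_norm : (fun x : E n => powerProfile γ ‖x‖) = omega γ :=
  funext fun x => powerProfile_of_nonneg (norm_nonneg x)

theorem continuous_omega (hγ : -3 < γ) : Continuous (omega γ : E n → ℝ) :=
  powerProfile_norm ▸ (continuous_powerProfile hγ).comp continuous_norm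

theorem tendstoUniformlyOn_powerProfile_norm_add {ι : Type*} {l : Filter ι} {e : ι → ℝ}
    (hγ : -3 < γ) (he : Tendsto e l (𝓝 0)) :
    TendstoUniformlyOn (fun i (x : E n) => powerProfile γ (‖x‖ + e i)) (omega γ) l
      (Metric.closedBall 0 R) := by
  have hunif := tendstoUniformlyOn_of_tendsto_param
    (F := fun t (x : E n) => powerProfile γ (‖x‖ + t))
    ((continuous_powerProfile hγ).comp (continuous_snd.norm.add continuous_fst))
    (isCompact_closedBall 0 R) he
  simpa only [add_zero, powerProfile_norm] using hunif

end PowerProfile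

section MinimalSolutions

variable {n : ℕ} {γ δ ε R c C : ℝ} {B : ℝ → ℝ}

theorem isPenalizedSuper_ball_const_iff (hR : R ≠ 0) {w : E n → ℝ} :
    IsPenalizedSuper γ B ε (Metric.ball 0 R) (fun _ => c) w ↔
      IsBallSuper (penalizedRHS γ B ε) R c w := by
  constructor
  · rintro ⟨hcont, hbdry, hsuper⟩
    rw [closure_ball _ hR] at hcont
    rw [frontier_ball _ hR] at hbdry
    exact ⟨hcont, fun x hx => hbdry (mem_sphere_zero_iff_norm.mpr hx), hsuper⟩
  · rintro ⟨hcont, hbdry, hsuper⟩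
    refine ⟨by rwa [closure_ball _ hR], ?_, hsuper⟩
    rw [frontier_ball _ hR]
    exact fun x hx => hbdry x (mem_sphere_zero_iff_norm.mp hx)

theorem exists_isMinimalSol_radial [NeZero n] (hγ : 0 ≤ γ) (hγ1 : γ < 1) (hB : IsCutoff δ B)
    (hε : 0 < ε) (hR : 0 < R) (hc : δ / 2 * ε ^ alpha γ < c) :
    ∃ g : ℝ → ℝ, IsMinimalSol γ B ε (Metric.ball (0 : E n) R) (fun _ => c) (fun x => g ‖x‖) ∧
      ∀ r ∈ Icc 0 R, powerProfile γ (r + (radius γ c - R)) ≤ g r := by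
  have hγ3 : -3 < γ := by linarith
  have hδ := hB.delta_pos
  obtain ⟨K, hK⟩ := exists_lipschitzWith_penalizedRHS hγ hB hε
  have h0 := penalizedRHS_nonneg (γ := γ) hB hε
  obtain ⟨g, P, hp, hP0, rfl, hleast⟩ :=
    exists_least_profile (n := n) hK h0 (penalizedRHS_le hγ hB hε) hR c
  have hg0 : 0 < g 0 := lt_of_lt_of_le (by positivity)
    (hp.le_init_of_lt hR.le h0 hP0 (fun s hs => penalizedRHS_eq_zero hB hε hs) hc)
  have hg : ∀ r ∈ Icc 0 R, 0 < g r := fun r hr =>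
    hg0.trans_le (hp.monotoneOn_val h0 hP0.ge (left_mem_Icc.mpr hR.le) hr hr.1)
  have hsol := hp.isViscositySol (n := n) hK.continuous h0 hP0
  have hclosure := closure_ball (0 : E n) hR.ne'
  refine ⟨g, ⟨hclosure ▸ hp.continuousOn_radial, fun x hx => ?_, hsol, fun x hx => ?_,
    fun w hw => hclosure ▸ hleast w ((isPenalizedSuper_ball_const_iff hR.ne').mp hw)⟩,
    fun r hr => ?_⟩
  · rw [frontier_ball _ hR.ne', mem_sphere_zero_iff_norm] at hx
    rw [hx]
  · exact (hg _ (norm_mem_Icc_of_mem_closedBall (hclosure ▸ hx))).le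
  · have hz := radius_pos hγ3 hγ1 (hg r hr)
    have hspeed := hp.radius_sub_radius_le hγ3 hγ1 h0
      (fun s hs => penalizedRHS_le_rpow hB hs.le) hP0 hg0 hr
    have hC := radialConst_pos hγ3 hγ1
    have hα := alpha_pos hγ3
    calc powerProfile γ (r + (radius γ (g R) - R))
        ≤ radialConst γ * radius γ (g r) ^ alpha γ := by
          unfold powerProfile
          gcongr
          exact max_le (by linarith) hz.le
      _ = g r := radialConst_mul_radius_rpow hγ3 hγ1 (hg r hr).le

theorem radialConst_mul_radius_mul_rpow (hγ : -3 < γ) (hγ1 : γ < 1) (hδ : 0 < δ) (hε : 0 ≤ ε) :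
    radialConst γ * (radius γ δ * ε) ^ alpha γ = δ * ε ^ alpha γ := by
  rw [Real.mul_rpow (radius_pos hγ hγ1 hδ).le hε, ← mul_assoc,
    radialConst_mul_radius_rpow hγ hγ1 hδ.le]

theorem mul_rpow_le_flatProfile (hγ : -3 < γ) (hγ1 : γ < 1) (hδ : 0 < δ) (hε : 0 < ε)
    (hR : 0 ≤ R) : δ * ε ^ alpha γ ≤ flatProfile γ (radius γ δ * ε) R := by
  rw [← radialConst_mul_radius_mul_rpow hγ hγ1 hδ hε.le]
  exact le_flatProfile hγ hγ1 (mul_pos (radius_pos hγ hγ1 hδ) hε) hR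

theorem IsMinimalSol.le_powerProfile (hγ : 0 ≤ γ) (hγ1 : γ < 1) (hB : IsCutoff δ B) (hε : 0 < ε)
    (hR : 0 < R) {u : E n → ℝ} (hu : IsMinimalSol γ B ε (Metric.ball 0 R)
      (fun _ => flatProfile γ (radius γ δ * ε) R) u) {x : E n} (hx : x ∈ Metric.closedBall 0 R) :
    u x ≤ powerProfile γ (‖x‖ + radius γ δ * ε) := by
  have hγ3 : -3 < γ := by linarith
  have hh : 0 < radius γ δ * ε := mul_pos (radius_pos hγ3 hγ1 hB.delta_pos) hε
  have hsuper : IsBallSuper (penalizedRHS γ B ε) R _ _ := isBallSuper_flatProfile (n := n) hγ hγ1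
    hh hR fun s hs => (penalizedRHS_eq_rpow hB hε
      ((radialConst_mul_radius_mul_rpow hγ3 hγ1 hB.delta_pos hε.le).ge.trans hs)).ge
  have hle := hu.least _ ((isPenalizedSuper_ball_const_iff hR.ne').mpr hsuper) x
    (by rwa [closure_ball _ hR.ne'])
  rw [powerProfile_of_nonneg (by positivity)]
  exact hle.trans (flatProfile_le hγ3 hγ1 hh.le (norm_nonneg x))

theorem tendsto_flatProfile (hγ : -3 < γ) (hγ1 : γ < 1) :
    Tendsto (fun h => flatProfile γ h R) (𝓝 0) (𝓝 (radialConst γ * R ^ alpha γ)) := by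
  have hα := alpha_pos hγ
  have hα1 := sub_pos.mpr (one_lt_alpha hγ hγ1)
  have hcont : Continuous fun h => flatProfile γ h R := by
    unfold flatProfile
    fun_prop (disch := positivity)
  simpa [flatProfile, Real.zero_rpow hα1.ne'] using hcont.tendsto 0

theorem isBoundaryDatum_const (Ω : Set (E n)) (hc : 0 ≤ c) : IsBoundaryDatum Ω fun _ => c := by
  refine ⟨fun _ _ => hc, fun _ => c, contDiff_const, ⟨0, ?_⟩, fun _ _ => rfl⟩
  rw [fderiv_fun_const]
  exact LipschitzWith.const _

theorem exists_radial_approximation [NeZero n] (hγ : 0 ≤ γ) (hγ1 : γ < 1) (hB : IsCutoff δ B)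
    (hR : 0 < R) (hCR : radialConst γ * R ^ alpha γ = C) :
    ∃ (c : ℝ → ℝ) (u : ℝ → E n → ℝ), Tendsto c (𝓝[>] 0) (𝓝 C) ∧
      IsLimitOfMinimal γ B (Metric.ball (0 : E n) R) (fun _ => C) (fun ε _ => c ε) u (omega γ) ∧
      (∀ ε, 0 < ε → ∀ x ∈ Metric.closedBall (0 : E n) R, ∀ y ∈ Metric.closedBall (0 : E n) R,
        ‖x‖ = ‖y‖ → u ε x = u ε y) ∧
      TendstoUniformlyOn u (omega γ) (𝓝[>] 0) (Metric.closedBall (0 : E n) R) := by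
  subst hCR
  have hγ3 : -3 < γ := by linarith
  have hδ := hB.delta_pos
  set c : ℝ → ℝ := fun ε => flatProfile γ (radius γ δ * ε) R
  have hclow : ∀ ε, 0 < ε → δ * ε ^ alpha γ ≤ c ε := fun ε hε =>
    mul_rpow_le_flatProfile hγ3 hγ1 hδ hε hR.le
  have hthreshold : ∀ ε, 0 < ε → δ / 2 * ε ^ alpha γ < c ε := fun ε hε =>
    lt_of_lt_of_le (by gcongr; linarith) (hclow ε hε)
  choose! g hmin hlow using fun (ε : ℝ) (hε : 0 < ε) =>
    exists_isMinimalSol_radial (n := n) hγ hγ1 hB hε hR (hthreshold ε hε)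
  have hshift : Tendsto (fun ε => radius γ δ * ε) (𝓝[>] 0) (𝓝 0) :=
    (continuous_const_mul (radius γ δ)).tendsto' 0 0 (mul_zero _) |>.mono_left nhdsWithin_le_nhds
  have hc : Tendsto c (𝓝[>] 0) (𝓝 (radialConst γ * R ^ alpha γ)) :=
    (tendsto_flatProfile hγ3 hγ1).comp hshift
  have hradius : Tendsto (fun ε => radius γ (c ε) - R) (𝓝[>] 0) (𝓝 0) := by
    have hsub := (((continuous_radius hγ3).tendsto _).comp hc).sub_const R
    rwa [radius_radialConst_mul_rpow hγ3 hγ1 hR.le, sub_self] at hsub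
  have hpos : ∀ᶠ ε : ℝ in 𝓝[>] 0, 0 < ε := self_mem_nhdsWithin
  have hunif : TendstoUniformlyOn (fun ε (x : E n) => g ε ‖x‖) (omega γ) (𝓝[>] 0)
      (Metric.closedBall 0 R) :=
    tendstoUniformlyOn_of_le_of_le (tendstoUniformlyOn_powerProfile_norm_add hγ3 hradius)
      (tendstoUniformlyOn_powerProfile_norm_add hγ3 hshift)
      (hpos.mono fun ε hε x hx => hlow ε hε _ (norm_mem_Icc_of_mem_closedBall hx))
      (hpos.mono fun ε hε x hx => (hmin ε hε).le_powerProfile hγ hγ1 hB hε hR hx)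
  refine ⟨c, fun ε x => g ε ‖x‖, hc, ?_, fun ε _ x _ y _ hxy => by simp only [hxy], hunif⟩
  exact
    { datum := fun ε hε =>
        isBoundaryDatum_const _ (le_trans (by positivity) (hclow ε hε))
      datum_tendsto := hc.tendstoUniformlyOn_const _
      minimal := hmin
      tendsto := (hunif.mono Metric.ball_subset_closedBall).tendstoLocallyUniformlyOn
      continuousOn := (continuous_omega hγ3).continuousOn
      boundary := eqOn_omega_frontier_ball hR.ne' }

end MinimalSolutions

theorem frontier_sdiff_singleton_inter {X : Type*} [TopologicalSpace X] [T1Space X] {U : Set X}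
    (hU : IsOpen U) {x : X} [(𝓝[≠] x).NeBot] (hx : x ∈ U) : frontier (U \ {x}) ∩ U = {x} := by
  rw [sdiff_eq, inter_comm U, frontier_inter_open_inter hU, frontier_compl, frontier,
    closure_singleton, interior_singleton, sdiff_empty]
  exact inter_eq_left.mpr (singleton_subset_iff.mpr hx)

theorem le_of_eventually_mul_rpow_le {A K a b : ℝ} (hA : 0 < A)
    (h : ∀ᶠ t in 𝓝[>] (0 : ℝ), A * t ^ a ≤ K * t ^ b) : b ≤ a := by
  by_contra! hab
  have hlim : Tendsto (fun t : ℝ => K * t ^ (b - a)) (𝓝[>] 0) (𝓝 0) :=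
    ((continuous_const.mul (Real.continuous_rpow_const (sub_pos.mpr hab).le)).tendsto' 0 0
      (by simp [Real.zero_rpow (sub_pos.mpr hab).ne'])).mono_left nhdsWithin_le_nhds
  refine hA.not_ge (ge_of_tendsto hlim ?_)
  filter_upwards [h, self_mem_nhdsWithin] with t hle (ht : 0 < t)
  rwa [Real.rpow_sub ht, ← mul_div_assoc, le_div_iff₀ (Real.rpow_pos_of_pos ht a)]

section ExplicitProfiles

variable {n : ℕ} {γ ε r R : ℝ}

theorem omega_zero (hγ : -3 < γ) : omega γ (0 : E n) = 0 := by
  rw [omega, norm_zero, Real.zero_rpow (alpha_pos hγ).ne', mul_zero]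

theorem omegaShift_zero_right : omegaShift γ ε (0 : E n) = radialConst γ * ε ^ alpha γ := by
  rw [omegaShift, norm_zero, zero_add]

theorem lt_omegaShift_iff (hγ : -3 < γ) (hγ1 : γ < 1) (hε : 0 ≤ ε) {x : E n} :
    radialConst γ * ε ^ alpha γ < omegaShift γ ε x ↔ x ≠ 0 := by
  rw [omegaShift, mul_lt_mul_iff_right₀ (radialConst_pos hγ hγ1),
    Real.rpow_lt_rpow_iff hε (by positivity) (alpha_pos hγ), lt_add_iff_pos_left, norm_pos_iff]

theorem frontier_lt_omegaShift_inter_ball [NeZero n] (hγ : -3 < γ) (hγ1 : γ < 1) (hε : 0 ≤ ε)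
    (hR : 0 < R) :
    frontier {x | x ∈ Metric.ball (0 : E n) R ∧ radialConst γ * ε ^ alpha γ < omegaShift γ ε x} ∩
      Metric.ball 0 R = {0} := by
  simp only [lt_omegaShift_iff hγ hγ1 hε]
  exact frontier_sdiff_singleton_inter Metric.isOpen_ball (Metric.mem_ball_self hR)

theorem omega_pos_iff (hγ : -3 < γ) (hγ1 : γ < 1) {x : E n} : 0 < omega γ x ↔ x ≠ 0 := by
  simpa [omegaShift_zero_left, Real.zero_rpow (alpha_pos hγ).ne'] using
    lt_omegaShift_iff (x := x) hγ hγ1 le_rfl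

theorem freeBoundary_omega [NeZero n] (hγ : -3 < γ) (hγ1 : γ < 1) (hR : 0 < R) :
    freeBoundary (Metric.ball (0 : E n) R) (omega γ) = {0} := by
  simp only [freeBoundary, omega_pos_iff hγ hγ1]
  exact frontier_sdiff_singleton_inter Metric.isOpen_ball (Metric.mem_ball_self hR)

theorem le_omegaShift (hγ : -3 < γ) (hγ1 : γ < 1) (hε : 0 ≤ ε) (x : E n) :
    radialConst γ * ε ^ alpha γ ≤ omegaShift γ ε x := by
  rcases eq_or_ne x 0 with rfl | hx
  · exact omegaShift_zero_right.ge
  · exact ((lt_omegaShift_iff hγ hγ1 hε).mpr hx).le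

theorem isLeast_omegaShift (hγ : -3 < γ) (hγ1 : γ < 1) (hε : 0 ≤ ε) (hR : 0 < R) :
    IsLeast (omegaShift γ ε '' Metric.ball (0 : E n) R) (radialConst γ * ε ^ alpha γ) :=
  ⟨⟨0, Metric.mem_ball_self hR, omegaShift_zero_right⟩,
    forall_mem_image.mpr fun x _ => le_omegaShift hγ hγ1 hε x⟩

theorem tendsto_radialConst_mul_add_rpow (hγ : -3 < γ) :
    Tendsto (fun ε => radialConst γ * (R + ε) ^ alpha γ) (𝓝[>] 0)
      (𝓝 (radialConst γ * R ^ alpha γ)) := by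
  have hcont : Continuous fun ε => radialConst γ * (R + ε) ^ alpha γ :=
    continuous_const.mul ((continuous_const.add continuous_id).rpow_const
      fun _ => Or.inr (alpha_pos hγ).le)
  exact (hcont.tendsto' 0 _ (by rw [add_zero])).mono_left nhdsWithin_le_nhds

theorem tendstoUniformlyOn_omegaShift (hγ : -3 < γ) :
    TendstoUniformlyOn (fun ε => omegaShift (n := n) γ ε) (omega γ) (𝓝[>] 0)
      (Metric.closedBall 0 R) := by
  refine (tendstoUniformlyOn_powerProfile_norm_add hγ
    (tendsto_id.mono_left nhdsWithin_le_nhds)).congr ?_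
  filter_upwards [self_mem_nhdsWithin] with ε (hε : 0 < ε) x _
  exact powerProfile_of_nonneg (by positivity)

theorem isFreeBoundarySol_omega (hγ : -3 < γ) (hγ1 : γ < 1) (hR : R ≠ 0) :
    IsFreeBoundarySol γ (Metric.ball (0 : E n) R) (fun _ => radialConst γ * R ^ alpha γ)
      (omega γ) where
  continuousOn := (continuous_omega hγ).continuousOn
  nonneg x _ := mul_nonneg (radialConst_pos hγ hγ1).le (by positivity)
  sol := by
    rw [← omegaShift_zero_left]
    refine isViscositySol_omegaShift hγ hγ1 le_rfl (fun x hx => ?_) fun _ _ => rfl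
    rw [omegaShift_zero_left] at hx
    exact (omega_pos_iff hγ hγ1).mp hx.2
  boundary := eqOn_omega_frontier_ball hR

theorem isLUB_omega [NeZero n] (hγ : -3 < γ) (hγ1 : γ < 1) (hr : 0 < r) :
    IsLUB (omega γ '' Metric.ball (0 : E n) r) (radialConst γ * r ^ alpha γ) := by
  refine isLUB_of_mem_closure ?_ ?_
  · rintro _ ⟨x, hx, rfl⟩
    have hC := radialConst_pos hγ hγ1
    have hα := alpha_pos hγ
    have hxr := (mem_ball_zero_iff.mp hx).le
    rw [omega]
    gcongr
  · obtain ⟨x, hx⟩ := exists_norm_eq (E n) hr.le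
    refine image_closure_subset_closure_image (continuous_omega hγ) ⟨x, ?_, by rw [omega, hx]⟩
    rw [closure_ball _ hr.ne', mem_closedBall_zero_iff, hx]

theorem isC1HolderAt_omega (hγ : -3 < γ) (hγ1 : γ < 1) :
    IsC1HolderAt (alpha γ - 1) (omega γ) (0 : E n) := by
  refine ⟨0, radialConst γ, 1, one_pos, fun y _ => ?_⟩
  have hC := radialConst_pos hγ hγ1
  rw [omega_zero hγ, zero_apply, sub_zero, sub_zero, sub_zero, add_sub_cancel, omega,
    abs_of_nonneg (by positivity)]

/- Averaging the expansion over `±x` removes the linear part. -/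
theorem le_of_isC1HolderAt_omega [NeZero n] (hγ : -3 < γ) (hγ1 : γ < 1) {β : ℝ}
    (h : IsC1HolderAt β (omega γ) (0 : E n)) : β ≤ alpha γ - 1 := by
  obtain ⟨p, K, r, hr, hp⟩ := h
  refine le_sub_iff_add_le'.mpr (le_of_eventually_mul_rpow_le (radialConst_pos hγ hγ1) (K := K) ?_)
  filter_upwards [Ioo_mem_nhdsGT hr] with t ht
  obtain ⟨x, rfl⟩ := exists_norm_eq (E n) ht.1.le
  have hplus := hp x (mem_ball_zero_iff.mpr ht.2)
  have hminus := hp (-x) (mem_ball_zero_iff.mpr (by rw [norm_neg]; exact ht.2))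
  rw [omega_zero hγ] at hplus hminus
  simp only [sub_zero, omega, norm_neg, map_neg] at hplus hminus
  linarith [(abs_le.mp hplus).2, (abs_le.mp hminus).2]

end ExplicitProfiles

end SingInf

theorem proposition6p1 (n : ℕ) (hn : 0 < n) (γ : ℝ) (hγ0 : 0 ≤ γ) (hγ1 : γ < 1)
    (δ : ℝ) (B : ℝ → ℝ) (hB : SingInf.IsCutoff δ B)
    (C R : ℝ) (hC : 0 < C) (hR : 0 < R)
    (hRC : R = (C / SingInf.radialConst γ) ^ (1 / SingInf.alpha γ)) :
    -- `ω` is a limiting solution in `B_R` with boundary datum `C`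
    SingInf.IsLimitingSol γ B (Metric.ball (0 : SingInf.E n) R) (fun _ => C) (SingInf.omega γ) ∧
    -- the approximating minimal solutions can be taken radial, with constant boundary data
    (∃ Cε : ℝ → ℝ, ∃ uε : ℝ → SingInf.E n → ℝ, Tendsto Cε (𝓝[>] 0) (𝓝 C) ∧
      SingInf.IsLimitOfMinimal γ B (Metric.ball (0 : SingInf.E n) R) (fun _ => C)
        (fun ε _ => Cε ε) uε (SingInf.omega γ) ∧
      (∀ ε, 0 < ε → ∀ x ∈ Metric.closedBall (0 : SingInf.E n) R,
        ∀ y ∈ Metric.closedBall (0 : SingInf.E n) R, ‖x‖ = ‖y‖ → uε ε x = uε ε y) ∧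
      TendstoUniformlyOn uε (SingInf.omega γ) (𝓝[>] 0)
        (Metric.closedBall (0 : SingInf.E n) R)) ∧
    -- `ω` solves the free boundary problem
    SingInf.IsFreeBoundarySol γ (Metric.ball (0 : SingInf.E n) R) (fun _ => C)
      (SingInf.omega γ) ∧
    -- the explicit profiles `ω_ε`
    (∀ ε, 0 < ε → δ ≤ SingInf.radialConst γ →
      SingInf.IsViscositySol (SingInf.penalizedRHS γ B ε)
        (Metric.ball (0 : SingInf.E n) R \ {0}) (SingInf.omegaShift γ ε)) ∧
    (∀ ε, 0 < ε → ∀ x ∈ frontier (Metric.ball (0 : SingInf.E n) R),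
      SingInf.omegaShift γ ε x = SingInf.radialConst γ * (R + ε) ^ SingInf.alpha γ) ∧
    Tendsto (fun ε : ℝ => SingInf.radialConst γ * (R + ε) ^ SingInf.alpha γ)
      (𝓝[>] 0) (𝓝 C) ∧
    TendstoUniformlyOn (fun ε => SingInf.omegaShift (n := n) γ ε) (SingInf.omega γ) (𝓝[>] 0)
      (Metric.closedBall (0 : SingInf.E n) R) ∧
    (∀ ε, 0 < ε →
      IsLeast (SingInf.omegaShift γ ε '' Metric.ball (0 : SingInf.E n) R)
        (SingInf.radialConst γ * ε ^ SingInf.alpha γ) ∧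
      frontier {x | x ∈ Metric.ball (0 : SingInf.E n) R ∧
          SingInf.radialConst γ * ε ^ SingInf.alpha γ < SingInf.omegaShift γ ε x} ∩
        Metric.ball (0 : SingInf.E n) R = {0}) ∧
    -- the free boundary is the origin
    SingInf.freeBoundary (Metric.ball (0 : SingInf.E n) R) (SingInf.omega γ) = {0} ∧
    -- the exponent `α` is attained at the free boundary and cannot be improved
    (∀ r, 0 < r → r ≤ R →
      IsLUB (SingInf.omega γ '' Metric.ball (0 : SingInf.E n) r)
        (SingInf.radialConst γ * r ^ SingInf.alpha γ)) ∧
    SingInf.IsC1HolderAt (SingInf.alpha γ - 1) (SingInf.omega γ) (0 : SingInf.E n) ∧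
    (∀ β, SingInf.alpha γ - 1 < β →
      ¬ SingInf.IsC1HolderAt β (SingInf.omega γ) (0 : SingInf.E n)) := by
  have : NeZero n := ⟨hn.ne'⟩
  have hγ : -3 < γ := by linarith
  obtain rfl : SingInf.radialConst γ * R ^ SingInf.alpha γ = C :=
    hRC ▸ SingInf.radialConst_mul_radius_rpow hγ hγ1 hC.le
  obtain ⟨c, u, hc, hlim, hradial, hunif⟩ :=
    SingInf.exists_radial_approximation (n := n) hγ0 hγ1 hB hR rfl
  refine ⟨⟨_, _, hlim⟩, ⟨c, u, hc, hlim, hradial, hunif⟩,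
    SingInf.isFreeBoundarySol_omega hγ hγ1 hR.ne', fun ε hε hδ => ?_,
    fun ε _ => SingInf.eqOn_omegaShift_frontier_ball hR.ne',
    SingInf.tendsto_radialConst_mul_add_rpow hγ, SingInf.tendstoUniformlyOn_omegaShift hγ,
    fun ε hε => ⟨SingInf.isLeast_omegaShift hγ hγ1 hε.le hR,
      SingInf.frontier_lt_omegaShift_inter_ball hγ hγ1 hε.le hR⟩,
    SingInf.freeBoundary_omega hγ hγ1 hR, fun r hr _ => SingInf.isLUB_omega hγ hγ1 hr,
    SingInf.isC1HolderAt_omega hγ hγ1,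
    fun β hβ h => hβ.not_ge (SingInf.le_of_isC1HolderAt_omega hγ hγ1 h)⟩
  exact SingInf.isViscositySol_omegaShift hγ hγ1 hε.le (fun x hx => hx.2) fun x _ =>
    SingInf.penalizedRHS_eq_rpow hB hε
      (le_trans (by gcongr) (SingInf.le_omegaShift hγ hγ1 hε.le x))
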